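/- **Setting.** All functions below are complex-valued and smooth. Subscripts $X,T$ (or $x,t$) denote partial derivatives in real variables. Let $D\subseteq\mathbb R^2$ be open with $D=-D$. A *seed* on $D$ is a triple $(u,v,\rho)$ solving the reverse space-time (RST) nonlocal short pulse equation in the $(X,T)$-plane: $$u_{XT}=-2u\rho,\quad \rho_T=-(uv)_X,\quad v(X,T)=-u(-X,-T),\quad \rho^2-u_Xv_X=1. \tag{1}$$ Its Lax pair with spectral parameter $\lambda\ne0$ is $\Phi_X=U\Phi$, $\Phi_T=V\Phi$, where $$U=\frac1{2\lambda}\begin{pmatrix}-i\rho&-iu_X\\ iv_X&i\rho\end{pmatrix},\qquad V=\begin{pmatrix}-i\lambda&u\\ v&i\lambda\end{pmatrix}.$$ Let $N\ge1$, let $\lambda_1,\dots,\lambda_{2N}\in\mathbb C\setminus\{0\}$, and let $\Phi_j=(\phi_j,\psi_j)^T$ be solutions on $D$ of the Lax pair with $\lambda=\lambda_j$. Let $W_N$ be the $2N\times2N$ matrix with rows $(\phi_j,\psi_j,\lambda_j\phi_j,\lambda_j\psi_j,\dots,\lambda_j^{N-1}\phi_j,\lambda_j^{N-1}\psi_j)$.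 Let $\mu_1=(\lambda_j^N\phi_j)_j$ and $\mu_2=(\lambda_j^N\psi_j)_j$ (columns). For $r,s\in\{1,2\}$ let $\Delta[N]_{rs}$ be minus the determinant of $W_N$ with column $2N-2+s$ replaced by $\mu_r$. Let $\Omega=\{p\in D: |W_N(p)|\neq0\}$. Statements 1-3 hold at every point of $\Omega$. 1. **Cramer's rule.** There is exactly one matrix polynomial $$T_N(\lambda)=\lambda^N I+\sum_{i=0}^{N-1}\lambda^i\begin{pmatrix}a_i&b_i\\c_i&d_i\end{pmatrix}\quad\text{with}\quad T_N(\lambda_j)\Phi_j=0,\ j=1,\dots,2N.$$ Its coefficients are given by Cramer's rule: the $(r,s)$ entry of the $i$-th coefficient is $-1/|W_N|$ times the determinant of $W_N$ with column $2i+s$ replaced by $\mu_r$. In particular the entries of the coefficient of $\lambda^{N-1}$ are $\Delta[N]_{rs}/|W_N|$. 2. **Bordered determinants.** Put $\eta_1=(1,0,\lambda,0,\dots,\lambda^{N-1},0)$ and $\eta_2=(0,1,0,\lambda,\dots,0,\lambda^{N-1})$. Then $$T_N(\lambda)_{rs}=\frac1{|W_N|}\begin{vmatrix}\eta_s&\delta_{rs}\lambda^N\\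 W_N&\mu_r\end{vmatrix}.$$ For $w=(w_1,w_2)^T$ and $\xi=(w_1,w_2,\lambda w_1,\lambda w_2,\dots,\lambda^{N-1}w_1,\lambda^{N-1}w_2)$, $$(T_N(\lambda)w)_r=\frac1{|W_N|}\begin{vmatrix}\xi&\lambda^Nw_r\\ W_N&\mu_r\end{vmatrix}.$$ 3. **Iteration.** The one-fold Darboux matrix $\lambda I+\begin{pmatrix}a_0&b_0\\c_0&d_0\end{pmatrix}$ is the case $N=1$ of item 1. It acts on potentials by $u\mapsto u+2ib_0$, $v\mapsto v-2ic_0$, $\rho\mapsto\rho+2i(a_0)_X$. Apply it successively, building the $k$-th factor from the transforms of $\Phi_{2k-1},\Phi_{2k}$ under the previous $k-1$ factors. If $|W_k|\ne0$ for $k=1,\dots,N$, every step is well defined, the product of the $N$ factors is $T_N(\lambda)$, and the iterated potentials are $$u^{[N]}=u+2i\frac{\Delta[N]_{12}}{|W_N|},\quad v^{[N]}=v-2i\frac{\Delta[N]_{21}}{|W_N|},\quad \rho^{[N]}=\rho+2i\Big(\frac{\Delta[N]_{11}}{|W_N|}\Big)_X. \tag{2}$$ 4. **Darboux transformation.** Define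 $u^{[N]},v^{[N]},\rho^{[N]}$ on $\Omega$ by (2), and let $U^{[N]},V^{[N]}$ be $U,V$ with these potentials. For all $\lambda\neq0$, on $\Omega$, with $T=T_N(\lambda)$: $T_X+TU=U^{[N]}T$ and $T_T+TV=V^{[N]}T$. Hence $T_N(\lambda)$ maps solutions of the Lax pair to solutions of the new Lax pair. On the open set $\Omega$ the new potentials satisfy $u^{[N]}_{XT}=-2u^{[N]}\rho^{[N]}$, $v^{[N]}_{XT}=-2v^{[N]}\rho^{[N]}$, $\rho^{[N]}_T=-(u^{[N]}v^{[N]})_X$ and $(\rho^{[N]})^2-u^{[N]}_Xv^{[N]}_X=1$. 5. **Nonlocal reduction.** Suppose that on $D$, for $k=1,\dots,N$, $$\phi_{2k-1}(X,T)=\psi_{2k-1}(-X,-T),\qquad \phi_{2k}(X,T)=-\psi_{2k}(-X,-T). \tag{3}$$ Then $\Omega=-\Omega$ and $(u^{[N]},v^{[N]},\rho^{[N]})$ solves (1) on $\Omega$. 6. **Hodograph transformation.** Let $x_0$ be a primitive on $D$ of $\rho\,dX-uv\,dT$, and put $x^{[N]}=x_0+2i\Delta[N]_{11}/|W_N|$,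 $t=-T$. Then on $\Omega$, $x^{[N]}_X=\rho^{[N]}$ and $x^{[N]}_T=-u^{[N]}v^{[N]}$. Let $O\subseteq\Omega$ be open, with $x^{[N]}$ real and $\rho^{[N]}\ne0$ on $O$, and let $h=(x^{[N]},-T)$ on $O$. Then $h$ is locally injective. If $q,r$ are functions with $q\circ h=u^{[N]}$ and $r\circ h=v^{[N]}$ on $O$, then on the open set $h(O)$ they are smooth and satisfy $$q_{xt}-2q+(qrq_x)_x=0,\qquad r_{xt}-2r+(rqr_x)_x=0.$$ 7. **$N$-soliton solutions of the RST nonlocal short pulse equation.** Assume (3), and let the integration constant in $x_0$ be such that $x_0(p)+x_0(-p)=2i\sum_{j=1}^{2N}\lambda_j$ on $D$. Then $x^{[N]}$ is odd on $\Omega$, and $(q^{[N]},x^{[N]})$ with $q^{[N]}=u^{[N]}$, $t=-T$ is a parametric solution of $$q_{xt}(x,t)-2q(x,t)-\big(q(x,t)q(-x,-t)q_x(x,t)\big)_x=0. \tag{4}$$ That is, for $q=q^{[N]}$ as a function of $(X,T)$, (4) holds wherever $x^{[N]}_X\neq0$, with $\partial_x=\frac1{x^{[N]}_X}\partial_X$,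 $\partial_t=-\partial_T+\frac{x^{[N]}_T}{x^{[N]}_X}\partial_X$ and $q(-x,-t)$ read as $q^{[N]}(-X,-T)$. If $O$ in item 6 satisfies $O=-O$, every function $q$ with $q\circ h=u^{[N]}$ on $O$ is a smooth solution of (4) on $h(O)=-h(O)$. Every $p_0\in O$ with $p_0=0$ or $h(p_0)\neq0$ has an open neighbourhood $O'=-O'\subseteq O$ on which $h$ is injective, so such $q$ exist on $h(O')$. 8. **Zero seed.** $u=v=0$, $\rho=1$ is a seed on $\mathbb R^2$, with $x_0=X+C$ for any constant $C$. For $\lambda\ne0$, the smooth solutions of its Lax pair on $\mathbb R^2$ are exactly $$\Phi=\begin{pmatrix}A\,e^{-\frac{iX}{2\lambda}-i\lambda T}\\ B\,e^{\frac{iX}{2\lambda}+i\lambda T}\end{pmatrix},\qquad A,B\in\mathbb C.$$ Let $\Phi_j$ be these functions with $\lambda=\lambda_j$, $A=A_j$, $B=B_j$, where $B_{2k-1}=A_{2k-1}$ and $B_{2k}=-A_{2k}$ for $k=1,\dots,N$. Then (3) holds, and $$q^{[N]}=2i\frac{\Delta[N]_{12}}{|W_N|},\qquad x^{[N]}=X+i\sum_{j=1}^{2N}\lambda_j+2i\frac{\Delta[N]_{11}}{|W_N|},\qquad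 t=-T$$ is a parametric solution of (4) on $\{|W_N|\ne0\}$, and gives solutions $q(x,t)$ of (4) as in item 7. If all $\lambda_j$ are purely imaginary, $q^{[N]}$ and $x^{[N]}$ are real-valued. -/

import Mathlib

open scoped ContDiff

noncomputable section

namespace ShortPulse

/-! ### Partial derivatives of functions of two real variables -/

/-- Partial derivative in the first variable (`X`, or `x`). -/
def dFst (f : ℝ × ℝ → ℂ) (p : ℝ × ℝ) : ℂ := deriv (fun s : ℝ => f (s, p.2)) p.1

/-- Partial derivative in the second variable (`T`, or `t`). -/
def dSnd (f : ℝ × ℝ → ℂ) (p : ℝ × ℝ) : ℂ := deriv (fun s : ℝ => f (p.1, s)) p.2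

/-- Invariance under reversal of space and time. -/
def IsReflSymm (D : Set (ℝ × ℝ)) : Prop := ∀ p ∈ D, -p ∈ D

/-! ### The equations -/

/-- `q` is a smooth solution on the open symmetric set `G` of the `(x,t)`-plane of the reverse
space-time nonlocal short pulse equation
`q_xt(x,t) - 2 q(x,t) + (- q(x,t) q(-x,-t) q_x(x,t))_x = 0`. -/
structure IsNonlocalSPSolution (q : ℝ × ℝ → ℂ) (G : Set (ℝ × ℝ)) : Prop where
  isOpen : IsOpen G
  symm : IsReflSymm G
  smooth : ContDiffOn ℝ ∞ q G
  eqn : ∀ z ∈ G,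
    dSnd (dFst q) z - 2 * q z + dFst (fun w => -(q w * q (-w) * dFst q w)) z = 0

/-- `(q, r)` is a smooth solution on the open set `G` of the `(x,t)`-plane of the two-component
short pulse system. -/
structure IsSPSystemSolution (q r : ℝ × ℝ → ℂ) (G : Set (ℝ × ℝ)) : Prop where
  isOpen : IsOpen G
  smooth_q : ContDiffOn ℝ ∞ q G
  smooth_r : ContDiffOn ℝ ∞ r G
  eqn_q : ∀ z ∈ G,
    dSnd (dFst q) z - 2 * q z + dFst (fun w => q w * r w * dFst q w) z = 0
  eqn_r : ∀ z ∈ G,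
    dSnd (dFst r) z - 2 * r z + dFst (fun w => r w * q w * dFst r w) z = 0

/-- The two-component form, on the set `D` of the `(X,T)`-plane, of the transformed system:
`u_XT = -2uρ`, `v_XT = -2vρ`, `ρ_T = -(uv)_X`, with the normalization `ρ² - u_X v_X = 1`. -/
structure IsPlaneSystemSolution (u v ρ : ℝ × ℝ → ℂ) (D : Set (ℝ × ℝ)) : Prop where
  isOpen : IsOpen D
  smooth_u : ContDiffOn ℝ ∞ u D
  smooth_v : ContDiffOn ℝ ∞ v D
  smooth_ρ : ContDiffOn ℝ ∞ ρ D
  eqn_u : ∀ p ∈ D, dSnd (dFst u) p = -2 * u p * ρ p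
  eqn_v : ∀ p ∈ D, dSnd (dFst v) p = -2 * v p * ρ p
  eqn_ρ : ∀ p ∈ D, dSnd ρ p = -dFst (fun s => u s * v s) p
  normalized : ∀ p ∈ D, ρ p ^ 2 - dFst u p * dFst v p = 1

/-- The reverse space-time nonlocal short pulse equation in the `(X,T)`-plane, on the symmetric
open set `D`: `u_XT = -2uρ`, `ρ_T = -(uv)_X`, `v(X,T) = -u(-X,-T)`, with the normalization
`ρ² - u_X v_X = 1` of the hodograph transformation. -/
structure IsPlaneNonlocalSolution (u v ρ : ℝ × ℝ → ℂ) (D : Set (ℝ × ℝ)) : Prop where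
  isOpen : IsOpen D
  symm : IsReflSymm D
  smooth_u : ContDiffOn ℝ ∞ u D
  smooth_v : ContDiffOn ℝ ∞ v D
  smooth_ρ : ContDiffOn ℝ ∞ ρ D
  eqn_u : ∀ p ∈ D, dSnd (dFst u) p = -2 * u p * ρ p
  eqn_ρ : ∀ p ∈ D, dSnd ρ p = -dFst (fun s => u s * v s) p
  nonlocal : ∀ p ∈ D, v p = -u (-p)
  normalized : ∀ p ∈ D, ρ p ^ 2 - dFst u p * dFst v p = 1

/-! ### The Lax pair in the `(X,T)`-plane -/

def laxU (u v ρ : ℝ × ℝ → ℂ) (l : ℂ) (p : ℝ × ℝ) : Matrix (Fin 2) (Fin 2) ℂ :=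
  (1 / (2 * l)) • !![-Complex.I * ρ p, -Complex.I * dFst u p;
                     Complex.I * dFst v p, Complex.I * ρ p]

def laxV (u v : ℝ × ℝ → ℂ) (l : ℂ) (p : ℝ × ℝ) : Matrix (Fin 2) (Fin 2) ℂ :=
  !![-Complex.I * l, u p; v p, Complex.I * l]

/-- `Φ = (φ, ψ)ᵀ` is a smooth solution on `D` of the Lax pair `Φ_X = UΦ`, `Φ_T = VΦ` with
spectral parameter `l`; `φ` is the component `0` and `ψ` the component `1`. -/
structure IsEigenfunction (u v ρ : ℝ × ℝ → ℂ) (l : ℂ) (Φ : ℝ × ℝ → Fin 2 → ℂ)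
    (D : Set (ℝ × ℝ)) : Prop where
  smooth : ∀ i, ContDiffOn ℝ ∞ (fun p => Φ p i) D
  eqn_X : ∀ p ∈ D, (fun i => dFst (fun s => Φ s i) p) = (laxU u v ρ l p).mulVec (Φ p)
  eqn_T : ∀ p ∈ D, (fun i => dSnd (fun s => Φ s i) p) = (laxV u v l p).mulVec (Φ p)

/-! ### Determinants

`lam j` and `F j` are the eigenvalue and the value at a point of the eigenfunction with number
`j + 1`; the first `2N` of them are used. -/

/-- `W_N`: the row `j` is `(φ_j, ψ_j, λ_j φ_j, λ_j ψ_j, …, λ_j^(N-1) φ_j, λ_j^(N-1) ψ_j)`. -/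
def wMat (N : ℕ) (lam : ℕ → ℂ) (F : ℕ → Fin 2 → ℂ) :
    Matrix (Fin (2 * N)) (Fin (2 * N)) ℂ :=
  Matrix.of fun j c => lam j ^ ((c : ℕ) / 2) * F j (Fin.ofNat 2 (c : ℕ))

/-- `W_N` with the column number `k` replaced by `(λ_j^N F_j r)_j`. -/
def wRepl (N : ℕ) (lam : ℕ → ℂ) (F : ℕ → Fin 2 → ℂ) (k : ℕ) (r : Fin 2) :
    Matrix (Fin (2 * N)) (Fin (2 * N)) ℂ :=
  Matrix.of fun j c => if (c : ℕ) = k then lam j ^ N * F j r else wMat N lam F j c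

/-- `Δ[N]` with indices `r + 1`, `s + 1`: minus the determinant of `W_N` with its last `φ`-column
(`s = 0`) or its last `ψ`-column (`s = 1`) replaced by `λ_j^N φ_j` (`r = 0`) or `λ_j^N ψ_j`
(`r = 1`). -/
def delta (N : ℕ) (lam : ℕ → ℂ) (F : ℕ → Fin 2 → ℂ) (r s : Fin 2) : ℂ :=
  -(wRepl N lam F (2 * (N - 1) + (s : ℕ)) r).det

/-- The matrix coefficient `(a_i, b_i; c_i, d_i)` given by Cramer's rule. -/
def dtCoeff (N : ℕ) (lam : ℕ → ℂ) (F : ℕ → Fin 2 → ℂ) (i : ℕ) : Matrix (Fin 2) (Fin 2) ℂ :=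
  Matrix.of fun r s => -(wRepl N lam F (2 * i + (s : ℕ)) r).det / (wMat N lam F).det

/-- The `N`-fold Darboux matrix
`T_N(z) = z^N + ∑_{i < N} z^i (a_i, b_i; c_i, d_i)`. -/
def dtMat (N : ℕ) (lam : ℕ → ℂ) (F : ℕ → Fin 2 → ℂ) (z : ℂ) : Matrix (Fin 2) (Fin 2) ℂ :=
  z ^ N • (1 : Matrix (Fin 2) (Fin 2) ℂ) + ∑ i ∈ Finset.range N, z ^ i • dtCoeff N lam F i

/-- The bordered matrix with first row `(η, x)` and the row `(W_N row j, λ_j^N F_j r)` for every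
`j`. -/
def bordered (N : ℕ) (lam : ℕ → ℂ) (F : ℕ → Fin 2 → ℂ) (η : Fin (2 * N) → ℂ) (x : ℂ)
    (r : Fin 2) : Matrix (Fin (2 * N + 1)) (Fin (2 * N + 1)) ℂ :=
  Matrix.of (Fin.cons (α := fun _ => Fin (2 * N + 1) → ℂ)
    (Fin.snoc (α := fun _ => ℂ) η x)
    (fun j => Fin.snoc (α := fun _ => ℂ) (wMat N lam F j) (lam j ^ N * F j r)))

/-- `(1, 0, z, 0, z², 0, …)` for `s = 0` and `(0, 1, 0, z, 0, z², …)` for `s = 1`. -/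
def etaRow (N : ℕ) (s : Fin 2) (z : ℂ) (c : Fin (2 * N)) : ℂ :=
  if (c : ℕ) % 2 = (s : ℕ) then z ^ ((c : ℕ) / 2) else 0

/-- `(φ, ψ, zφ, zψ, …, z^(N-1) φ, z^(N-1) ψ)`. -/
def xiRow (N : ℕ) (w : Fin 2 → ℂ) (z : ℂ) (c : Fin (2 * N)) : ℂ :=
  z ^ ((c : ℕ) / 2) * w (Fin.ofNat 2 (c : ℕ))

/-! ### The one-fold transformation and its iteration -/

/-- `|W_1|` for two vectors. -/
def oneDet (f g : Fin 2 → ℂ) : ℂ := !![f 0, f 1; g 0, g 1].det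

/-- The coefficient `(a_0, b_0; c_0, d_0)` of the one-fold Darboux matrix
`z + (a_0, b_0; c_0, d_0)` built from eigenvectors `f`, `g` with eigenvalues `l`, `m`. -/
def oneCoeff (l m : ℂ) (f g : Fin 2 → ℂ) : Matrix (Fin 2) (Fin 2) ℂ :=
  !![-(!![l * f 0, f 1; m * g 0, g 1].det / oneDet f g),
     -(!![f 0, l * f 0; g 0, m * g 0].det / oneDet f g);
     -(!![l * f 1, f 1; m * g 1, g 1].det / oneDet f g),
     -(!![f 0, l * f 1; g 0, m * g 1].det / oneDet f g)]

/-- The product of the first `k` one-fold Darboux matrices; the next factor is built from the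
transforms of the next two eigenvectors by the product of the previous factors, taken at their
eigenvalues. -/
def iterDT (lam : ℕ → ℂ) (F : ℕ → Fin 2 → ℂ) : ℕ → ℂ → Matrix (Fin 2) (Fin 2) ℂ
  | 0, _ => 1
  | k + 1, z =>
      (z • (1 : Matrix (Fin 2) (Fin 2) ℂ)
        + oneCoeff (lam (2 * k)) (lam (2 * k + 1))
            ((iterDT lam F k (lam (2 * k))).mulVec (F (2 * k)))
            ((iterDT lam F k (lam (2 * k + 1))).mulVec (F (2 * k + 1))))
      * iterDT lam F k z

/-- The eigenvector number `j` after `k` one-fold transformations. -/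
def iterEig (lam : ℕ → ℂ) (F : ℕ → Fin 2 → ℂ) (k j : ℕ) : Fin 2 → ℂ :=
  (iterDT lam F k (lam j)).mulVec (F j)

/-- The coefficient `(a_0, b_0; c_0, d_0)` of the factor number `k + 1`. -/
def stepCoeff (lam : ℕ → ℂ) (F : ℕ → Fin 2 → ℂ) (k : ℕ) : Matrix (Fin 2) (Fin 2) ℂ :=
  oneCoeff (lam (2 * k)) (lam (2 * k + 1)) (iterEig lam F k (2 * k)) (iterEig lam F k (2 * k + 1))

/-- The values of all eigenfunctions at a point. -/
def vals (Φ : ℕ → ℝ × ℝ → Fin 2 → ℂ) (p : ℝ × ℝ) (j : ℕ) : Fin 2 → ℂ := Φ j p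

/-- `u` after `k` one-fold transformations `u ↦ u + 2i b_0`. -/
def iterU (u : ℝ × ℝ → ℂ) (lam : ℕ → ℂ) (Φ : ℕ → ℝ × ℝ → Fin 2 → ℂ) : ℕ → ℝ × ℝ → ℂ
  | 0, p => u p
  | k + 1, p => iterU u lam Φ k p + 2 * Complex.I * stepCoeff lam (vals Φ p) k 0 1

/-- `v` after `k` one-fold transformations `v ↦ v - 2i c_0`. -/
def iterV (v : ℝ × ℝ → ℂ) (lam : ℕ → ℂ) (Φ : ℕ → ℝ × ℝ → Fin 2 → ℂ) : ℕ → ℝ × ℝ → ℂ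
  | 0, p => v p
  | k + 1, p => iterV v lam Φ k p - 2 * Complex.I * stepCoeff lam (vals Φ p) k 1 0

/-- `ρ` after `k` one-fold transformations `ρ ↦ ρ + 2i (a_0)_X`. -/
def iterRho (ρ : ℝ × ℝ → ℂ) (lam : ℕ → ℂ) (Φ : ℕ → ℝ × ℝ → Fin 2 → ℂ) : ℕ → ℝ × ℝ → ℂ
  | 0, p => ρ p
  | k + 1, p => iterRho ρ lam Φ k p
      + 2 * Complex.I * dFst (fun s => stepCoeff lam (vals Φ s) k 0 0) p

/-! ### The determinant formulas -/

/-- `|W_N|` as a function on the `(X,T)`-plane. -/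
def wDet (N : ℕ) (lam : ℕ → ℂ) (Φ : ℕ → ℝ × ℝ → Fin 2 → ℂ) (p : ℝ × ℝ) : ℂ :=
  (wMat N lam (vals Φ p)).det

/-- The part of `D` where `|W_N| ≠ 0`. -/
def regSet (N : ℕ) (lam : ℕ → ℂ) (Φ : ℕ → ℝ × ℝ → Fin 2 → ℂ) (D : Set (ℝ × ℝ)) :
    Set (ℝ × ℝ) := {p ∈ D | wDet N lam Φ p ≠ 0}

def uNew (u : ℝ × ℝ → ℂ) (N : ℕ) (lam : ℕ → ℂ) (Φ : ℕ → ℝ × ℝ → Fin 2 → ℂ) (p : ℝ × ℝ) : ℂ :=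
  u p + 2 * Complex.I * (delta N lam (vals Φ p) 0 1 / wDet N lam Φ p)

def vNew (v : ℝ × ℝ → ℂ) (N : ℕ) (lam : ℕ → ℂ) (Φ : ℕ → ℝ × ℝ → Fin 2 → ℂ) (p : ℝ × ℝ) : ℂ :=
  v p - 2 * Complex.I * (delta N lam (vals Φ p) 1 0 / wDet N lam Φ p)

def ρNew (ρ : ℝ × ℝ → ℂ) (N : ℕ) (lam : ℕ → ℂ) (Φ : ℕ → ℝ × ℝ → Fin 2 → ℂ) (p : ℝ × ℝ) : ℂ :=
  ρ p + 2 * Complex.I * dFst (fun s => delta N lam (vals Φ s) 0 0 / wDet N lam Φ s) p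

/-- `x^[N] = x⁰ + 2i Δ[N]₁₁ / |W_N|`, where `x⁰ = ∫ ρ dX - ∫ uv dT`. -/
def xNew (x₀ : ℝ × ℝ → ℂ) (N : ℕ) (lam : ℕ → ℂ) (Φ : ℕ → ℝ × ℝ → Fin 2 → ℂ) (p : ℝ × ℝ) : ℂ :=
  x₀ p + 2 * Complex.I * (delta N lam (vals Φ p) 0 0 / wDet N lam Φ p)

/-- The reduction of the eigenfunctions: in the numbering from `1`,
`φ_{2k-1}(X,T) = ψ_{2k-1}(-X,-T)` and `φ_{2k}(X,T) = -ψ_{2k}(-X,-T)` for `k = 1, …, N`. -/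
def HasReduction (N : ℕ) (Φ : ℕ → ℝ × ℝ → Fin 2 → ℂ) (D : Set (ℝ × ℝ)) : Prop :=
  ∀ k < N, ∀ p ∈ D,
    Φ (2 * k) p 0 = Φ (2 * k) (-p) 1 ∧ Φ (2 * k + 1) p 0 = -Φ (2 * k + 1) (-p) 1

/-! ### The hodograph transformation `dx = ρ dX - uv dT`, `t = -T` -/

/-- `x` is a primitive of `ρ dX - uv dT` on `D`. -/
structure IsHodograph (u v ρ x : ℝ × ℝ → ℂ) (D : Set (ℝ × ℝ)) : Prop where
  smooth : ContDiffOn ℝ ∞ x D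
  eqn_X : ∀ p ∈ D, dFst x p = ρ p
  eqn_T : ∀ p ∈ D, dSnd x p = -(u p * v p)

/-- `∂/∂x` in the parameters `(X,T)`, for the change of variables `(X,T) ↦ (x(X,T), -T)`. -/
def hodDx (x f : ℝ × ℝ → ℂ) (p : ℝ × ℝ) : ℂ := dFst f p / dFst x p

/-- `∂/∂t` in the parameters `(X,T)`, for the change of variables `(X,T) ↦ (x(X,T), -T)`. -/
def hodDt (x f : ℝ × ℝ → ℂ) (p : ℝ × ℝ) : ℂ := -dSnd f p + dSnd x p * hodDx x f p

/-- `(q, x)` is a parametric solution, with parameters `(X,T)` in `D` and `t = -T`, of the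
reverse space-time nonlocal short pulse equation; `x` may be complex. The point `-p` of the
parameter plane has the coordinates `-x(p)`, `-t(p)`. The equation is required
where the change of variables is regular. -/
structure IsParametricSolution (q x : ℝ × ℝ → ℂ) (D : Set (ℝ × ℝ)) : Prop where
  isOpen : IsOpen D
  symm : IsReflSymm D
  smooth_q : ContDiffOn ℝ ∞ q D
  smooth_x : ContDiffOn ℝ ∞ x D
  odd : ∀ p ∈ D, x (-p) = -x p
  eqn : ∀ p ∈ D, dFst x p ≠ 0 →
    hodDt x (hodDx x q) p - 2 * q p + hodDx x (fun s => -(q s * q (-s) * hodDx x q s)) p = 0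

/-- The map `(X,T) ↦ (x(X,T), -T)` into the real `(x,t)`-plane, used where `x` is real. -/
def hodMap (x : ℝ × ℝ → ℂ) (p : ℝ × ℝ) : ℝ × ℝ := ((x p).re, -p.2)

/-- `O` is an open subset of `D` on which `x` is real and `x_X` has no zero, so that `hodMap x` is
a local diffeomorphism there. -/
structure IsRegion (x : ℝ × ℝ → ℂ) (D O : Set (ℝ × ℝ)) : Prop where
  isOpen : IsOpen O
  subset : O ⊆ D
  real : ∀ p ∈ O, (x p).im = 0
  regular : ∀ p ∈ O, dFst x p ≠ 0

/-! ### Zero seed -/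

/-- `(A e^{-iX/(2l) - ilT}, B e^{iX/(2l) + ilT})ᵀ`. -/
def expEig (l A B : ℂ) (p : ℝ × ℝ) : Fin 2 → ℂ :=
  ![A * Complex.exp (-(Complex.I * p.1 / (2 * l)) - Complex.I * l * p.2),
    B * Complex.exp (Complex.I * p.1 / (2 * l) + Complex.I * l * p.2)]

end ShortPulse

end

open ShortPulse

/-!
The proof rests on one fact of linear algebra. The rows of `W_N` evaluate row polynomials
`∑_{i < N} z^i E_i` on the data `(λ_j, Φ_j)`, so `|W_N| ≠ 0` says exactly that a polynomial of
degree less than `N` vanishing on all the data is zero (`row_eq_zero`, `coeff_eq_zero`). Cramer's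
rule gives the monic matrix polynomial `T_N` of degree `N` vanishing on the data
(`dtMat_mulVec_eq_zero`), and every further identity for `T_N` is proved by exhibiting a polynomial
of lower degree that vanishes on the data.

* A product of one-fold factors is monic and vanishes on the data, hence is `T_N`; its subleading
  coefficient is the sum of the coefficients of the factors (`iterate_step`, `dtCoeff_succ_eq`).
* Write `U = Q/z` and `V = P - izσ₃`. Differentiating `T_N(λ_j) Φ_j = 0` shows that
  `z T_X + T Q - Q' T` and `T_T + T V - V' T` vanish on the data. With
  `Q' = Q + (C_{N-1})_X` and `P' = P - i [C_{N-1}, σ₃]`, where `C_i` are the coefficients of `T_N`,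
  their degree is less than `N`, so they are zero, coefficient by coefficient
  (`coeff_relation_X`, `coeff_relation_T`). Multiplication of the rows of `W_N` by the `λ_j` is
  conjugate to the companion matrix of `T_N`, so `tr C_{N-1} = -∑ λ_j` is constant
  (`dtCoeff_trace`); hence `Q'` and `P'` are the Lax matrices of the new potentials.
* The constant term `C_0 = T_N(0)` is invertible because no `λ_j` vanishes. The relations at `i = 0`
  read `C_0 Q = Q' C_0` and `(C_0)_T = P' C_0 - C_0 P`. They carry `det Q` and the zero curvature
  equation `Q_T = [P, Q]` over to the new potentials (`isPlaneSystemSolution_new`). For the seed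
  the entry `v_XT = -2vρ` of this equation comes from the compatibility of the Lax pair on an
  eigenfunction (`eqn_v_of_eigenfunction`). A diagonal entry of the `T`-relation at `i = N - 1` is
  the formula for `x_T` (`isHodograph_new`).
* Where `x` is real and `x_X ≠ 0`, the map `(X,T) ↦ (x,-T)` is a local diffeomorphism by the inverse
  function theorem, and the short pulse equations become identities in the parameters
  (`parametric_eqn`, `IsRegion.chain_rule`).
* Under the reduction the data at `-p` are, up to signs, those at `p` with exchanged components.
  Uniqueness gives `C_i(-p) = S C_i(p) S` with `S` the exchange matrix (`dtCoeff_of_swap`), which is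
  the nonlocal relation between `u` and `v`; with the trace formula it also makes `x` odd. In the
  same way, complex conjugation of the linear system gives the reality statement
  (`dtCoeff_last_re`).
-/

namespace ShortPulse

open Matrix Finset Filter Topology

/-! ### The linear system of the Darboux coefficients -/

lemma sum_fin_two_mul {α : Type*} [AddCommMonoid α] (N : ℕ) (f : ℕ → Fin 2 → α) :
    ∑ c : Fin (2 * N), f ((c : ℕ) / 2) (Fin.ofNat 2 (c : ℕ))
      = ∑ i ∈ range N, (f i 0 + f i 1) := by
  rw [Fin.sum_univ_eq_sum_range (fun c => f (c / 2) (Fin.ofNat 2 c)) (2 * N)]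
  induction N with
  | zero => simp
  | succ n ih =>
    have h0 : Fin.ofNat 2 (2 * n) = 0 := by
      apply Fin.ext; simp [Fin.ofNat]
    have h1 : Fin.ofNat 2 (2 * n + 1) = 1 := by
      apply Fin.ext; simp [Fin.ofNat, Nat.add_mod]
    have h2 : (2 * n + 1) / 2 = n := by omega
    rw [show 2 * (n + 1) = 2 * n + 1 + 1 by ring, sum_range_succ, sum_range_succ, ih,
      sum_range_succ, h0, h1, h2, Nat.mul_div_cancel_left n (by norm_num), add_assoc]

/-- `W_N` applied to the coefficient vector of a row polynomial `∑ z^i E_i` evaluates that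
polynomial on the data `(λ_j, F_j)`. -/
lemma wMat_mulVec (N : ℕ) (lam : ℕ → ℂ) (F E : ℕ → Fin 2 → ℂ) (j : Fin (2 * N)) :
    (wMat N lam F).mulVec (fun c => E ((c : ℕ) / 2) (Fin.ofNat 2 (c : ℕ))) j
      = ∑ i ∈ range N, lam j ^ i * (E i ⬝ᵥ F j) := by
  have := sum_fin_two_mul N (fun i s => lam j ^ i * F j s * E i s)
  simp only [mulVec, dotProduct, wMat, of_apply, Fin.sum_univ_two]
  rw [this]
  refine sum_congr rfl fun i _ => by ring

/-- The coefficient vector of length `2N` of a row polynomial determines it. -/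
lemma exists_row_of_vec (N : ℕ) (x : Fin (2 * N) → ℂ) :
    ∃ E : ℕ → Fin 2 → ℂ, ∀ c : Fin (2 * N), E ((c : ℕ) / 2) (Fin.ofNat 2 (c : ℕ)) = x c := by
  refine ⟨fun i s => if h : 2 * i + (s : ℕ) < 2 * N then x ⟨2 * i + s, h⟩ else 0, fun c => ?_⟩
  have h : 2 * ((c : ℕ) / 2) + ((Fin.ofNat 2 (c : ℕ) : Fin 2) : ℕ) = c := by
    simp only [Fin.ofNat]; omega
  simp only [h, c.2, dite_true]

lemma row_apply_of_vec {N : ℕ} {E : ℕ → Fin 2 → ℂ} {x : Fin (2 * N) → ℂ}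
    (h : ∀ c : Fin (2 * N), E ((c : ℕ) / 2) (Fin.ofNat 2 (c : ℕ)) = x c) {i : ℕ} (hi : i < N)
    (s : Fin 2) : E i s = x ⟨2 * i + s, by omega⟩ := by
  rw [← h]
  have h1 : (2 * i + (s : ℕ)) / 2 = i := by omega
  have h2 : Fin.ofNat 2 (2 * i + (s : ℕ)) = s := by
    apply Fin.ext; simp only [Fin.ofNat]; omega
  simp only [h1, h2]

/-- If `|W_N| ≠ 0`, a row polynomial of degree less than `N` vanishing on all the data
`(λ_j, F_j)` is zero. -/
lemma row_eq_zero {N : ℕ} {lam : ℕ → ℂ} {F : ℕ → Fin 2 → ℂ} (hW : (wMat N lam F).det ≠ 0)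
    (E : ℕ → Fin 2 → ℂ)
    (h : ∀ j < 2 * N, ∑ i ∈ range N, lam j ^ i * (E i ⬝ᵥ F j) = 0) : ∀ i < N, E i = 0 := by
  have h0 := eq_zero_of_mulVec_eq_zero hW
    (v := fun c => E ((c : ℕ) / 2) (Fin.ofNat 2 (c : ℕ)))
    (by funext j; rw [wMat_mulVec]; exact h j j.2)
  intro i hi
  funext s
  rw [row_apply_of_vec (x := 0) (fun c => congrFun h0 c) hi s]; rfl

/-- Converse of `row_eq_zero`. -/
lemma wMat_det_ne_zero_of_rows {N : ℕ} {lam : ℕ → ℂ} {F : ℕ → Fin 2 → ℂ}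
    (h : ∀ E : ℕ → Fin 2 → ℂ, (∀ j < 2 * N, ∑ i ∈ range N, lam j ^ i * (E i ⬝ᵥ F j) = 0) →
      ∀ i < N, E i = 0) : (wMat N lam F).det ≠ 0 := by
  intro hW
  obtain ⟨x, hx, hx0⟩ := exists_mulVec_eq_zero_iff.2 hW
  obtain ⟨E, hE⟩ := exists_row_of_vec N x
  apply hx
  have hE0 := h E fun j hj => by
    rw [← wMat_mulVec N lam F E ⟨j, hj⟩, funext hE]; exact congrFun hx0 ⟨j, hj⟩
  funext c
  rw [← hE c, hE0 _ (by omega)]; rfl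

lemma sum_smul_mulVec_apply (N : ℕ) (z : ℂ) (C : ℕ → Matrix (Fin 2) (Fin 2) ℂ) (w : Fin 2 → ℂ)
    (r : Fin 2) :
    (∑ i ∈ range N, z ^ i • C i).mulVec w r = ∑ i ∈ range N, z ^ i * (C i r ⬝ᵥ w) := by
  rw [sum_mulVec, Finset.sum_apply]
  simp only [smul_mulVec, Pi.smul_apply, smul_eq_mul]
  rfl

/-- If `|W_N| ≠ 0`, a matrix polynomial of degree less than `N` vanishing on all the data
`(λ_j, F_j)` is zero. -/
lemma coeff_eq_zero {N : ℕ} {lam : ℕ → ℂ} {F : ℕ → Fin 2 → ℂ} (hW : (wMat N lam F).det ≠ 0)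
    (C : ℕ → Matrix (Fin 2) (Fin 2) ℂ)
    (h : ∀ j < 2 * N, (∑ i ∈ range N, lam j ^ i • C i).mulVec (F j) = 0) :
    ∀ i < N, C i = 0 := by
  intro i hi
  ext r s
  have := row_eq_zero hW (fun i => C i r)
    (fun j hj => by rw [← sum_smul_mulVec_apply]; exact congrFun (h j hj) r) i hi
  exact congrFun this s

/-- The matrix polynomial with leading term `z^N` and lower coefficients `C i`. -/
def monicPoly (N : ℕ) (C : ℕ → Matrix (Fin 2) (Fin 2) ℂ) (z : ℂ) : Matrix (Fin 2) (Fin 2) ℂ :=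
  z ^ N • (1 : Matrix (Fin 2) (Fin 2) ℂ) + ∑ i ∈ range N, z ^ i • C i

lemma monicPoly_mulVec_apply (N : ℕ) (z : ℂ) (C : ℕ → Matrix (Fin 2) (Fin 2) ℂ) (w : Fin 2 → ℂ)
    (r : Fin 2) :
    (monicPoly N C z).mulVec w r = z ^ N * w r + ∑ i ∈ range N, z ^ i * (C i r ⬝ᵥ w) := by
  rw [monicPoly, add_mulVec, Pi.add_apply, sum_smul_mulVec_apply]
  simp [smul_mulVec]

lemma wRepl_eq_updateCol (N : ℕ) (lam : ℕ → ℂ) (F : ℕ → Fin 2 → ℂ) (c : Fin (2 * N))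
    (r : Fin 2) :
    wRepl N lam F c r = (wMat N lam F).updateCol c (fun j => lam j ^ N * F j r) := by
  ext j c'
  simp only [wRepl, of_apply, updateCol_apply, Fin.ext_iff]

/-- The coefficient vector of the row `r` of `T_N` solves the linear system with matrix `W_N`. -/
lemma wMat_mulVec_dtCoeff {N : ℕ} {lam : ℕ → ℂ} {F : ℕ → Fin 2 → ℂ}
    (hW : (wMat N lam F).det ≠ 0) (r : Fin 2) :
    (wMat N lam F).mulVec
        (fun c : Fin (2 * N) => dtCoeff N lam F ((c : ℕ) / 2) r (Fin.ofNat 2 (c : ℕ)))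
      = fun j : Fin (2 * N) => -(lam j ^ N * F j r) := by
  have hvec : (fun c : Fin (2 * N) => dtCoeff N lam F ((c : ℕ) / 2) r (Fin.ofNat 2 (c : ℕ)))
      = (-(wMat N lam F).det⁻¹) • cramer (wMat N lam F) (fun j => lam j ^ N * F j r) := by
    funext c
    have h : 2 * ((c : ℕ) / 2) + ((Fin.ofNat 2 (c : ℕ) : Fin 2) : ℕ) = c := by
      simp only [Fin.ofNat]; omega
    rw [dtCoeff, of_apply, h, wRepl_eq_updateCol, Pi.smul_apply, cramer_apply, smul_eq_mul]
    ring
  rw [hvec, mulVec_smul, mulVec_cramer, smul_smul]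
  funext j
  simp [hW]

lemma dtMat_eq_monicPoly (N : ℕ) (lam : ℕ → ℂ) (F : ℕ → Fin 2 → ℂ) (z : ℂ) :
    dtMat N lam F z = monicPoly N (dtCoeff N lam F) z := rfl

lemma dtMat_mulVec_eq_zero {N : ℕ} {lam : ℕ → ℂ} {F : ℕ → Fin 2 → ℂ}
    (hW : (wMat N lam F).det ≠ 0) {j : ℕ} (hj : j < 2 * N) :
    (dtMat N lam F (lam j)).mulVec (F j) = 0 := by
  funext r
  have := congrFun (wMat_mulVec_dtCoeff hW r) ⟨j, hj⟩
  rw [wMat_mulVec N lam F (fun i => dtCoeff N lam F i r)] at this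
  rw [dtMat_eq_monicPoly, monicPoly_mulVec_apply, this]
  simp

/-- The coefficients of `T_N` are the only solution of the linear system. -/
lemma eq_dtCoeff {N : ℕ} {lam : ℕ → ℂ} {F : ℕ → Fin 2 → ℂ}
    (hW : (wMat N lam F).det ≠ 0) (C : ℕ → Matrix (Fin 2) (Fin 2) ℂ)
    (h : ∀ j < 2 * N, (monicPoly N C (lam j)).mulVec (F j) = 0) :
    ∀ i < N, C i = dtCoeff N lam F i := by
  intro i hi
  refine sub_eq_zero.1 (coeff_eq_zero hW (fun i => C i - dtCoeff N lam F i) (fun j hj => ?_) i hi)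
  have h1 := h j hj
  have h2 := dtMat_mulVec_eq_zero hW hj
  rw [dtMat_eq_monicPoly] at h2
  have h3 : ∑ i ∈ range N, lam j ^ i • (C i - dtCoeff N lam F i)
      = monicPoly N C (lam j) - monicPoly N (dtCoeff N lam F) (lam j) := by
    simp only [monicPoly, smul_sub, sum_sub_distrib]; abel
  rw [h3, sub_mulVec, h1, h2, sub_zero]

lemma monicPoly_congr {N : ℕ} {C C' : ℕ → Matrix (Fin 2) (Fin 2) ℂ} (h : ∀ i < N, C i = C' i)
    (z : ℂ) : monicPoly N C z = monicPoly N C' z := by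
  simp only [monicPoly]
  rw [sum_congr rfl fun i hi => by rw [h i (mem_range.1 hi)]]

lemma linear_system_iff {N : ℕ} {lam : ℕ → ℂ} {F : ℕ → Fin 2 → ℂ}
    (hW : (wMat N lam F).det ≠ 0) (C : Fin N → Matrix (Fin 2) (Fin 2) ℂ) :
    (∀ j < 2 * N, (lam j ^ N • (1 : Matrix (Fin 2) (Fin 2) ℂ)
        + ∑ i : Fin N, lam j ^ (i : ℕ) • C i).mulVec (F j) = 0) ↔
      ∀ i : Fin N, C i = dtCoeff N lam F i := by
  obtain ⟨C', hC'⟩ : ∃ C' : ℕ → Matrix (Fin 2) (Fin 2) ℂ, ∀ i : Fin N, C i = C' i :=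
    ⟨fun i => if h : i < N then C ⟨i, h⟩ else 0, fun i => by simp⟩
  have hp : ∀ z : ℂ, z ^ N • (1 : Matrix (Fin 2) (Fin 2) ℂ) + ∑ i : Fin N, z ^ (i : ℕ) • C i
      = monicPoly N C' z := fun z => by
    simp only [monicPoly, hC']
    rw [Fin.sum_univ_eq_sum_range (fun i => z ^ i • C' i) N]
  simp only [hp]
  simp only [hC']
  constructor
  · exact fun h i => eq_dtCoeff hW C' h i i.2
  · intro h j hj
    rw [monicPoly_congr (C' := dtCoeff N lam F) fun i hi => h ⟨i, hi⟩]
    exact dtMat_mulVec_eq_zero hW hj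

lemma dtCoeff_last (N : ℕ) (lam : ℕ → ℂ) (F : ℕ → Fin 2 → ℂ) (r s : Fin 2) :
    dtCoeff N lam F (N - 1) r s = delta N lam F r s / (wMat N lam F).det := rfl

/-! ### Bordered determinants -/

/-- Adding to the last column the combination of the others with coefficients `e` clears it,
when `W e = -μ`, up to the corner entry. -/
lemma bordered_det {N : ℕ} {lam : ℕ → ℂ} {F : ℕ → Fin 2 → ℂ}
    (hW : (wMat N lam F).det ≠ 0) (η : Fin (2 * N) → ℂ) (x : ℂ) (r : Fin 2) :
    (bordered N lam F η x r).det
      = (x + ∑ c : Fin (2 * N), dtCoeff N lam F ((c : ℕ) / 2) r (Fin.ofNat 2 (c : ℕ)) * η c)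
        * (wMat N lam F).det := by
  set e : Fin (2 * N) → ℂ := fun c => dtCoeff N lam F ((c : ℕ) / 2) r (Fin.ofNat 2 (c : ℕ))
    with he
  have hWe := wMat_mulVec_dtCoeff hW r
  have h1 := det_updateCol_sum (bordered N lam F η x r) (Fin.last _)
    (Fin.snoc (α := fun _ => ℂ) e 1)
  rw [Fin.snoc_last, one_smul] at h1
  -- In the expansion along the cleared last column only the corner survives; its sign is
  -- `(-1)^(2N) = 1`.
  rw [← h1, det_succ_column _ (Fin.last _), Fin.sum_univ_succ, sum_eq_zero]
  · have hs : ((bordered N lam F η x r).updateCol (Fin.last _) fun k =>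
        ∑ i, (Fin.snoc (α := fun _ => ℂ) e 1 : Fin (2 * N + 1) → ℂ) i
          • bordered N lam F η x r k i).submatrix (Fin.succAbove 0) (Fin.succAbove (Fin.last _))
        = wMat N lam F := by
      ext a b
      simp [bordered, (Fin.castSucc_lt_last b).ne]
    rw [hs]
    simp [bordered, Fin.sum_univ_castSucc, add_comm, he]
  · intro j _
    have h2 : ∑ c, e c * wMat N lam F j c = -(lam j ^ N * F j r) := by
      rw [← congrFun hWe j]
      simp only [mulVec, dotProduct, he]
      exact sum_congr rfl fun _ _ => mul_comm _ _
    simp [bordered, Fin.sum_univ_castSucc, h2]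

lemma dtMat_apply_eq_bordered {N : ℕ} {lam : ℕ → ℂ} {F : ℕ → Fin 2 → ℂ}
    (hW : (wMat N lam F).det ≠ 0) (z : ℂ) (r s : Fin 2) :
    dtMat N lam F z r s
      = (bordered N lam F (etaRow N s z) (if r = s then z ^ N else 0) r).det
          / (wMat N lam F).det := by
  rw [bordered_det hW, mul_div_cancel_right₀ _ hW]
  have h := sum_fin_two_mul N
    (fun i t => dtCoeff N lam F i r t * if (t : ℕ) = (s : ℕ) then z ^ i else 0)
  have h' : ∀ c : Fin (2 * N), etaRow N s z c
      = if ((Fin.ofNat 2 (c : ℕ) : Fin 2) : ℕ) = (s : ℕ) then z ^ ((c : ℕ) / 2) else 0 :=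
    fun c => rfl
  simp only [h']
  rw [h]
  simp only [dtMat, Matrix.add_apply, Matrix.smul_apply, Matrix.sum_apply, one_apply, smul_eq_mul, mul_ite, mul_one,
    mul_zero]
  congr 1
  refine sum_congr rfl fun i _ => ?_
  fin_cases s <;> simp [mul_comm]

lemma dtMat_mulVec_eq_bordered {N : ℕ} {lam : ℕ → ℂ} {F : ℕ → Fin 2 → ℂ}
    (hW : (wMat N lam F).det ≠ 0) (z : ℂ) (w : Fin 2 → ℂ) (r : Fin 2) :
    (dtMat N lam F z).mulVec w r
      = (bordered N lam F (xiRow N w z) (z ^ N * w r) r).det / (wMat N lam F).det := by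
  rw [bordered_det hW, mul_div_cancel_right₀ _ hW]
  have h := sum_fin_two_mul N (fun i t => dtCoeff N lam F i r t * (z ^ i * w t))
  simp only [xiRow]
  rw [h, dtMat_eq_monicPoly, monicPoly_mulVec_apply]
  congr 1
  refine sum_congr rfl fun i _ => ?_
  simp only [dotProduct, Fin.sum_univ_two]
  ring

/-! ### Nondegeneracy and trace -/

lemma vecMul_monicPoly_apply (N : ℕ) (C : ℕ → Matrix (Fin 2) (Fin 2) ℂ) (z : ℂ)
    (w f : Fin 2 → ℂ) :
    w ⬝ᵥ (monicPoly N C z).mulVec f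
      = z ^ N * (w ⬝ᵥ f) + ∑ i ∈ range N, z ^ i * ((w ᵥ* C i) ⬝ᵥ f) := by
  simp only [monicPoly, add_mulVec, sum_mulVec, smul_mulVec, one_mulVec, dotProduct_add,
    dotProduct_sum, dotProduct_smul, dotProduct_mulVec, smul_eq_mul]

/-- The constant coefficient `T_N(0)` is invertible: from `w T_N(0) = 0` one may divide `w T_N(z)`
by `z`, and the quotient, of degree `N - 1`, vanishes on the data, as all `λ_j` are nonzero. -/
lemma dtCoeff_zero_det_ne_zero {N : ℕ} (hN : 1 ≤ N) {lam : ℕ → ℂ}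
    (hlam : ∀ j < 2 * N, lam j ≠ 0) {F : ℕ → Fin 2 → ℂ} (hW : (wMat N lam F).det ≠ 0) :
    (dtCoeff N lam F 0).det ≠ 0 := by
  intro h0
  obtain ⟨w, hw, hw0⟩ := exists_vecMul_eq_zero_iff.2 h0
  obtain ⟨M, rfl⟩ : ∃ M, N = M + 1 := ⟨N - 1, by omega⟩
  have := row_eq_zero hW (fun i => if i = M then w else w ᵥ* dtCoeff (M + 1) lam F (i + 1))
    (fun j hj => ?_) M (by omega)
  · simp at this; exact hw this
  · have h1 := vecMul_monicPoly_apply (M + 1) (dtCoeff (M + 1) lam F) (lam j) w (F j)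
    rw [← dtMat_eq_monicPoly, dtMat_mulVec_eq_zero hW hj, dotProduct_zero, sum_range_succ', hw0]
      at h1
    rw [sum_range_succ]
    apply mul_left_cancel₀ (hlam j hj)
    rw [mul_zero, h1, mul_add, mul_sum, zero_dotProduct, mul_zero, add_zero, add_comm]
    congr 1
    · simp; ring
    · refine sum_congr rfl fun i hi => ?_
      rw [if_neg (by have := mem_range.1 hi; omega)]
      ring

/-- The trace of the subleading coefficient: multiplication of the rows of `W_N` by the `λ_j` is
conjugate by `W_N` to the block companion matrix of `T_N`. -/
lemma dtCoeff_trace {N : ℕ} (hN : 1 ≤ N) {lam : ℕ → ℂ} {F : ℕ → Fin 2 → ℂ}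
    (hW : (wMat N lam F).det ≠ 0) :
    dtCoeff N lam F (N - 1) 0 0 + dtCoeff N lam F (N - 1) 1 1 = -∑ j ∈ range (2 * N), lam j := by
  obtain ⟨M, rfl⟩ : ∃ M, N = M + 1 := ⟨N - 1, by omega⟩
  set W := wMat (M + 1) lam F with hWdef
  let K : Matrix (Fin (2 * (M + 1))) (Fin (2 * (M + 1))) ℂ := of fun c' c =>
    if (c : ℕ) / 2 < M then (if (c' : ℕ) = (c : ℕ) + 2 then 1 else 0)
    else -dtCoeff (M + 1) lam F ((c' : ℕ) / 2) (Fin.ofNat 2 (c : ℕ)) (Fin.ofNat 2 (c' : ℕ))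
  let Λ : Matrix (Fin (2 * (M + 1))) (Fin (2 * (M + 1))) ℂ :=
    diagonal fun j => lam j
  have hWK : W * K = Λ * W := by
    ext j c
    rw [diagonal_mul, mul_apply]
    by_cases hc : (c : ℕ) / 2 < M
    · have hc2 : (c : ℕ) + 2 < 2 * (M + 1) := by omega
      rw [sum_eq_single (⟨(c : ℕ) + 2, hc2⟩ : Fin (2 * (M + 1)))]
      · have h1 : ((c : ℕ) + 2) / 2 = (c : ℕ) / 2 + 1 := by omega
        have h2 : Fin.ofNat 2 ((c : ℕ) + 2) = Fin.ofNat 2 (c : ℕ) := by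
          apply Fin.ext; simp only [Fin.ofNat]; omega
        simp only [K, W, wMat, of_apply, hc, if_true, h1, h2, pow_succ]
        ring
      · intro b _ hb
        have : (b : ℕ) ≠ (c : ℕ) + 2 := fun h => hb (Fin.ext h)
        simp [K, hc, this]
      · simp
    · have h1 := congrFun (wMat_mulVec_dtCoeff hW (Fin.ofNat 2 (c : ℕ))) j
      have h2 : (c : ℕ) / 2 = M := by omega
      simp only [mulVec, dotProduct] at h1
      simp only [K, of_apply, hc, if_false, mul_neg, sum_neg_distrib]
      rw [h1]
      simp only [W, wMat, of_apply, h2, neg_neg, pow_succ]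
      ring
  have hdet : IsUnit W.det := isUnit_iff_ne_zero.2 hW
  have hK : K = W⁻¹ * (Λ * W) := by rw [← hWK, ← Matrix.mul_assoc, nonsing_inv_mul _ hdet, one_mul]
  have htr : K.trace = Λ.trace := by
    rw [hK, trace_mul_comm, Matrix.mul_assoc, mul_nonsing_inv _ hdet, mul_one]
  have hΛ : Λ.trace = ∑ j ∈ range (2 * (M + 1)), lam j := by
    rw [trace_diagonal, Fin.sum_univ_eq_sum_range]
  have hKt : K.trace = -(dtCoeff (M + 1) lam F M 0 0 + dtCoeff (M + 1) lam F M 1 1) := by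
    have h := sum_fin_two_mul (M + 1)
      (fun i t => if i < M then (0 : ℂ) else -dtCoeff (M + 1) lam F i t t)
    have h' : K.trace = ∑ c : Fin (2 * (M + 1)), if (c : ℕ) / 2 < M then (0 : ℂ)
        else -dtCoeff (M + 1) lam F ((c : ℕ) / 2) (Fin.ofNat 2 (c : ℕ)) (Fin.ofNat 2 (c : ℕ)) := by
      refine sum_congr rfl fun c _ => ?_
      simp [K]
    rw [h', h, sum_range_succ, sum_eq_zero]
    · simp; ring
    · intro i hi; simp [mem_range.1 hi]
  rw [Nat.add_sub_cancel, ← hΛ, ← htr, hKt, neg_neg]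

/-! ### Iteration -/

lemma oneCoeff_mulVec {l m : ℂ} {f g : Fin 2 → ℂ} (h : oneDet f g ≠ 0) :
    (l • (1 : Matrix (Fin 2) (Fin 2) ℂ) + oneCoeff l m f g).mulVec f = 0 ∧
    (m • (1 : Matrix (Fin 2) (Fin 2) ℂ) + oneCoeff l m f g).mulVec g = 0 := by
  have h' : f 0 * g 1 - f 1 * g 0 ≠ 0 := by simpa [oneDet, det_fin_two] using h
  obtain ⟨d, hd⟩ : ∃ d, f 0 * g 1 - f 1 * g 0 = d := ⟨_, rfl⟩
  rw [hd] at h'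
  constructor <;> funext r <;> fin_cases r <;>
    simp [oneCoeff, oneDet, det_fin_two, mulVec, dotProduct, Fin.sum_univ_two, one_apply, hd] <;>
    field_simp <;> rw [← hd] <;> ring

/-- The product of a monic linear factor with a monic polynomial of degree `k`. -/
lemma linear_mul_monicPoly (k : ℕ) (A : Matrix (Fin 2) (Fin 2) ℂ)
    (C : ℕ → Matrix (Fin 2) (Fin 2) ℂ) (z : ℂ) :
    (z • (1 : Matrix (Fin 2) (Fin 2) ℂ) + A) * monicPoly k C z
      = monicPoly (k + 1) (fun i => (if i = 0 then 0 else C (i - 1))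
          + (if i = k then A else A * C i)) z := by
  have h1 : ∑ i ∈ range (k + 1), z ^ i • (if i = 0 then 0 else C (i - 1))
      = z • ∑ i ∈ range k, z ^ i • C i := by
    rw [sum_range_succ', smul_sum]
    simp [pow_succ', smul_smul]
  have h2 : ∑ i ∈ range (k + 1), z ^ i • (if i = k then A else A * C i)
      = z ^ k • A + A * ∑ i ∈ range k, z ^ i • C i := by
    rw [sum_range_succ, Matrix.mul_sum, add_comm]
    congr 1
    · simp
    · refine sum_congr rfl fun i hi => ?_
      rw [if_neg (by have := mem_range.1 hi; omega), Matrix.mul_smul]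
  simp only [monicPoly, smul_add, sum_add_distrib, h1, h2, add_mul, mul_add, smul_mul,
    Matrix.mul_smul, one_mul, mul_one, smul_smul, pow_succ', mul_comm z]
  abel

/-- The transforms by `T_k` of the next two eigenvectors are independent if `|W_{k+1}| ≠ 0`: if a
row `w` annihilated both, the row polynomial `w T_k(z)`, of degree `k`, would vanish on all the
`2(k + 1)` data. -/
lemma oneDet_ne_zero {k : ℕ} {lam : ℕ → ℂ} {F : ℕ → Fin 2 → ℂ}
    (hk : ∀ j < 2 * k, (dtMat k lam F (lam j)).mulVec (F j) = 0)
    (hW : (wMat (k + 1) lam F).det ≠ 0) :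
    oneDet ((dtMat k lam F (lam (2 * k))).mulVec (F (2 * k)))
      ((dtMat k lam F (lam (2 * k + 1))).mulVec (F (2 * k + 1))) ≠ 0 := by
  set f := (dtMat k lam F (lam (2 * k))).mulVec (F (2 * k)) with hf
  set g := (dtMat k lam F (lam (2 * k + 1))).mulVec (F (2 * k + 1)) with hg
  intro h
  obtain ⟨w, hw, hw0⟩ := exists_mulVec_eq_zero_iff.2 h
  have hwf : w ⬝ᵥ f = 0 := by
    have := congrFun hw0 0
    simpa [mulVec, dotProduct, Fin.sum_univ_two, mul_comm] using this
  have hwg : w ⬝ᵥ g = 0 := by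
    have := congrFun hw0 1
    simpa [mulVec, dotProduct, Fin.sum_univ_two, mul_comm] using this
  have := row_eq_zero hW (fun i => if i = k then w else w ᵥ* dtCoeff k lam F i)
    (fun j hj => ?_) k (by omega)
  · simp at this; exact hw this
  · have h1 := vecMul_monicPoly_apply k (dtCoeff k lam F) (lam j) w (F j)
    have h2 : w ⬝ᵥ (monicPoly k (dtCoeff k lam F) (lam j)).mulVec (F j) = 0 := by
      rw [← dtMat_eq_monicPoly]
      rcases (by omega : j < 2 * k ∨ j = 2 * k ∨ j = 2 * k + 1) with h | h | h
      · rw [hk j h, dotProduct_zero]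
      · rw [h]; exact hwf
      · rw [h]; exact hwg
    rw [h2] at h1
    rw [h1, sum_range_succ, add_comm]
    congr 1
    · simp
    · refine sum_congr rfl fun i hi => ?_
      rw [if_neg (by have := mem_range.1 hi; omega)]

lemma dtMat_zero (lam : ℕ → ℂ) (F : ℕ → Fin 2 → ℂ) (z : ℂ) : dtMat 0 lam F z = 1 := by
  simp [dtMat]

/-- One step of the iteration: the product of the factor number `k + 1` with `T_k` is monic and
vanishes on the first `2(k + 1)` data, so its coefficients are those of `T_{k+1}`. -/
lemma iterate_step {k : ℕ} {lam : ℕ → ℂ} {F : ℕ → Fin 2 → ℂ}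
    (hk : ∀ j < 2 * k, (dtMat k lam F (lam j)).mulVec (F j) = 0)
    (hiter : ∀ z, iterDT lam F k z = dtMat k lam F z)
    (hW : (wMat (k + 1) lam F).det ≠ 0) :
    (∀ i < k + 1, (if i = 0 then 0 else dtCoeff k lam F (i - 1))
        + (if i = k then stepCoeff lam F k else stepCoeff lam F k * dtCoeff k lam F i)
        = dtCoeff (k + 1) lam F i) ∧
      ∀ z, iterDT lam F (k + 1) z = dtMat (k + 1) lam F z := by
  have hone := oneDet_ne_zero hk hW
  simp only [← hiter] at hone
  obtain ⟨hf, hg⟩ := oneCoeff_mulVec (l := lam (2 * k)) (m := lam (2 * k + 1)) hone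
  have hprod : ∀ z, iterDT lam F (k + 1) z = monicPoly (k + 1)
      (fun i => (if i = 0 then 0 else dtCoeff k lam F (i - 1))
        + (if i = k then stepCoeff lam F k else stepCoeff lam F k * dtCoeff k lam F i)) z := by
    intro z
    rw [← linear_mul_monicPoly, ← dtMat_eq_monicPoly, ← hiter]
    rfl
  have hkill : ∀ j < 2 * (k + 1), (iterDT lam F (k + 1) (lam j)).mulVec (F j) = 0 := by
    intro j hj
    simp only [iterDT]
    rw [← mulVec_mulVec]
    rcases (by omega : j < 2 * k ∨ j = 2 * k ∨ j = 2 * k + 1) with h | h | h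
    · rw [hiter (lam j), hk j h, mulVec_zero]
    · subst h; exact hf
    · subst h; exact hg
  have hco := eq_dtCoeff hW _ (fun j hj => by rw [← hprod]; exact hkill j hj)
  exact ⟨hco, fun z => by rw [hprod, monicPoly_congr hco, dtMat_eq_monicPoly]⟩

lemma iterDT_eq_dtMat {lam : ℕ → ℂ} {F : ℕ → Fin 2 → ℂ} (N : ℕ)
    (hW : ∀ k, 1 ≤ k → k ≤ N → (wMat k lam F).det ≠ 0) (z : ℂ) :
    iterDT lam F N z = dtMat N lam F z := by
  induction N generalizing z with
  | zero => rw [dtMat_zero]; rfl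
  | succ k ih =>
    refine (iterate_step (fun j hj => ?_) (fun z => ih (fun i h1 h2 => hW i h1 (by omega)) z)
      (hW (k + 1) (by omega) le_rfl)).2 z
    exact dtMat_mulVec_eq_zero (hW k (by omega) (by omega)) hj

/-- The coefficients of the factor number `k + 1` are the increments of the subleading
coefficient of `T_k`. -/
lemma dtCoeff_succ_eq {k : ℕ} {lam : ℕ → ℂ} {F : ℕ → Fin 2 → ℂ}
    (hW : ∀ i, 1 ≤ i → i ≤ k + 1 → (wMat i lam F).det ≠ 0) :
    dtCoeff (k + 1) lam F k
      = (if k = 0 then 0 else dtCoeff k lam F (k - 1)) + stepCoeff lam F k := by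
  have h := (iterate_step
    (fun j hj => dtMat_mulVec_eq_zero (hW k (by omega) (by omega)) hj)
    (iterDT_eq_dtMat k fun i h1 h2 => hW i h1 (by omega)) (hW (k + 1) (by omega) le_rfl)).1 k
    (by omega)
  rw [← h]; simp

lemma iterEig_oneDet_ne_zero {N : ℕ} {lam : ℕ → ℂ} {F : ℕ → Fin 2 → ℂ}
    (hW : ∀ i, 1 ≤ i → i ≤ N → (wMat i lam F).det ≠ 0) {k : ℕ} (hk : k < N) :
    oneDet (iterEig lam F k (2 * k)) (iterEig lam F k (2 * k + 1)) ≠ 0 := by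
  have hT := iterDT_eq_dtMat k fun i h1 h2 => hW i h1 (by omega)
  simp only [iterEig, hT]
  exact oneDet_ne_zero (fun j hj => dtMat_mulVec_eq_zero (hW k (by omega) (by omega)) hj)
    (hW (k + 1) (by omega) (by omega))

/-! ### Partial derivatives -/

/-- The derivative of `f` at `p` in the direction `e`. -/
noncomputable def dDir (e : ℝ × ℝ) (f : ℝ × ℝ → ℂ) (p : ℝ × ℝ) : ℂ := fderiv ℝ f p e

section Rules

variable {e p : ℝ × ℝ} {f g : ℝ × ℝ → ℂ}

lemma dFst_eq_dDir (hf : DifferentiableAt ℝ f p) : dFst f p = dDir (1, 0) f p := by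
  have h : HasDerivAt (fun s : ℝ => (s, p.2)) ((1 : ℝ), (0 : ℝ)) p.1 :=
    (hasDerivAt_id p.1).prodMk (hasDerivAt_const p.1 p.2)
  exact (HasFDerivAt.comp_hasDerivAt (f := fun s : ℝ => (s, p.2)) p.1 hf.hasFDerivAt h).deriv

lemma dSnd_eq_dDir (hf : DifferentiableAt ℝ f p) : dSnd f p = dDir (0, 1) f p := by
  have h : HasDerivAt (fun s : ℝ => (p.1, s)) ((0 : ℝ), (1 : ℝ)) p.2 :=
    (hasDerivAt_const p.2 p.1).prodMk (hasDerivAt_id p.2)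
  exact (HasFDerivAt.comp_hasDerivAt (f := fun s : ℝ => (p.1, s)) p.2 hf.hasFDerivAt h).deriv

lemma dFst_congr (h : f =ᶠ[𝓝 p] g) : dFst f p = dFst g p := by
  have hc : Tendsto (fun s : ℝ => (s, p.2)) (𝓝 p.1) (𝓝 p) :=
    (Continuous.tendsto (by fun_prop : Continuous fun s : ℝ => (s, p.2)) p.1)
  exact EventuallyEq.deriv_eq (hc.eventually h)

lemma dSnd_congr (h : f =ᶠ[𝓝 p] g) : dSnd f p = dSnd g p := by
  have hc : Tendsto (fun s : ℝ => (p.1, s)) (𝓝 p.2) (𝓝 p) :=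
    (Continuous.tendsto (by fun_prop : Continuous fun s : ℝ => (p.1, s)) p.2)
  exact EventuallyEq.deriv_eq (hc.eventually h)

lemma dDir_congr (h : f =ᶠ[𝓝 p] g) : dDir e f p = dDir e g p := by
  rw [dDir, dDir, h.fderiv_eq]

lemma dDir_const (c : ℂ) : dDir e (fun _ => c) p = 0 := by simp [dDir]

lemma dDir_add (hf : DifferentiableAt ℝ f p) (hg : DifferentiableAt ℝ g p) :
    dDir e (fun y => f y + g y) p = dDir e f p + dDir e g p := by
  simp [dDir, fderiv_fun_add hf hg]

lemma dDir_sub (hf : DifferentiableAt ℝ f p) (hg : DifferentiableAt ℝ g p) :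
    dDir e (fun y => f y - g y) p = dDir e f p - dDir e g p := by
  simp [dDir, fderiv_fun_sub hf hg]

lemma dDir_mul (hf : DifferentiableAt ℝ f p) (hg : DifferentiableAt ℝ g p) :
    dDir e (fun y => f y * g y) p = dDir e f p * g p + f p * dDir e g p := by
  simp [dDir, fderiv_fun_mul hf hg]; ring

lemma dDir_const_mul (c : ℂ) (hf : DifferentiableAt ℝ f p) :
    dDir e (fun y => c * f y) p = c * dDir e f p := by
  rw [dDir_mul (differentiableAt_const c) hf, dDir_const]; ring

lemma dDir_div (hf : DifferentiableAt ℝ f p) (hg : DifferentiableAt ℝ g p) (h0 : g p ≠ 0) :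
    dDir e (fun y => f y / g y) p = (dDir e f p * g p - f p * dDir e g p) / g p ^ 2 := by
  have hne : ∀ᶠ y in 𝓝 p, g y ≠ 0 := hg.continuousAt.eventually_ne h0
  have hd : DifferentiableAt ℝ (fun y => f y / g y) p := by
    simp only [div_eq_mul_inv]
    exact hf.fun_mul (hg.fun_inv h0)
  have h1 := dDir_mul (e := e) hd hg
  have h2 : dDir e (fun y => f y / g y * g y) p = dDir e f p :=
    dDir_congr (hne.mono fun y hy => div_mul_cancel₀ _ hy)
  rw [h2] at h1
  rw [h1]
  field_simp
  ring

lemma dDir_sum {ι : Type*} (t : Finset ι) {f : ι → ℝ × ℝ → ℂ}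
    (hf : ∀ i ∈ t, DifferentiableAt ℝ (f i) p) :
    dDir e (fun y => ∑ i ∈ t, f i y) p = ∑ i ∈ t, dDir e (f i) p := by
  simp [dDir, fderiv_fun_sum hf]

end Rules

section Smooth

variable {D : Set (ℝ × ℝ)} {f : ℝ × ℝ → ℂ} {p : ℝ × ℝ}

lemma differentiableAt_of_smooth (hD : IsOpen D) (hf : ContDiffOn ℝ ∞ f D) (hp : p ∈ D) :
    DifferentiableAt ℝ f p :=
  (hf.contDiffAt (hD.mem_nhds hp)).differentiableAt (by simp)

lemma contDiffOn_dDir (hD : IsOpen D) (hf : ContDiffOn ℝ ∞ f D) (e : ℝ × ℝ) :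
    ContDiffOn ℝ ∞ (dDir e f) D :=
  (hf.fderiv_of_isOpen hD (m := ∞) (by simp)).clm_apply contDiffOn_const

lemma contDiffOn_dFst (hD : IsOpen D) (hf : ContDiffOn ℝ ∞ f D) : ContDiffOn ℝ ∞ (dFst f) D :=
  (contDiffOn_dDir hD hf (1, 0)).congr fun _ hp =>
    dFst_eq_dDir (differentiableAt_of_smooth hD hf hp)

lemma contDiffOn_dSnd (hD : IsOpen D) (hf : ContDiffOn ℝ ∞ f D) : ContDiffOn ℝ ∞ (dSnd f) D :=
  (contDiffOn_dDir hD hf (0, 1)).congr fun _ hp =>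
    dSnd_eq_dDir (differentiableAt_of_smooth hD hf hp)

lemma dSnd_dFst_comm (hD : IsOpen D) (hf : ContDiffOn ℝ ∞ f D) (hp : p ∈ D) :
    dSnd (dFst f) p = dFst (dSnd f) p := by
  have hcd : ContDiffAt ℝ ∞ f p := hf.contDiffAt (hD.mem_nhds hp)
  have hd2 : DifferentiableAt ℝ (fderiv ℝ f) p :=
    ((hf.fderiv_of_isOpen hD (m := ∞) (by simp)).contDiffAt (hD.mem_nhds hp)).differentiableAt
      (by simp)
  have key : ∀ a b : ℝ × ℝ, dDir a (dDir b f) p = fderiv ℝ (fderiv ℝ f) p a b := fun a b => by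
    have := (hd2.hasFDerivAt.clm_apply (hasFDerivAt_const b p)).fderiv
    rw [dDir]
    change fderiv ℝ (fun y => fderiv ℝ f y b) p a = _
    rw [this]; simp
  rw [dSnd_eq_dDir (differentiableAt_of_smooth hD (contDiffOn_dFst hD hf) hp),
    dFst_eq_dDir (differentiableAt_of_smooth hD (contDiffOn_dSnd hD hf) hp),
    dDir_congr (g := dDir (1, 0) f), dDir_congr (g := dDir (0, 1) f) (e := (1, 0)), key, key]
  · exact hcd.isSymmSndFDerivAt (by simpa using WithTop.coe_le_coe.2 (le_top : (2 : ℕ∞) ≤ ⊤)) _ _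
  · filter_upwards [hD.mem_nhds hp] with y hy
    exact dSnd_eq_dDir (differentiableAt_of_smooth hD hf hy)
  · filter_upwards [hD.mem_nhds hp] with y hy
    exact dFst_eq_dDir (differentiableAt_of_smooth hD hf hy)

lemma contDiffOn_det {n : Type*} [Fintype n] [DecidableEq n] {A : ℝ × ℝ → Matrix n n ℂ}
    (h : ∀ i j, ContDiffOn ℝ ∞ (fun p => A p i j) D) :
    ContDiffOn ℝ ∞ (fun p => (A p).det) D := by
  simp only [det_apply']
  exact ContDiffOn.sum fun σ _ => contDiffOn_const.mul (contDiffOn_prod fun i _ => h _ _)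

end Smooth

/-! ### Matrices of functions -/

/-- Entrywise derivative at `p` in the direction `e`. -/
noncomputable def mDir (e : ℝ × ℝ) (A : ℝ × ℝ → Matrix (Fin 2) (Fin 2) ℂ) (p : ℝ × ℝ) :
    Matrix (Fin 2) (Fin 2) ℂ := of fun r s => dDir e (fun y => A y r s) p

lemma mDir_mul {e p : ℝ × ℝ} {A B : ℝ × ℝ → Matrix (Fin 2) (Fin 2) ℂ}
    (hA : ∀ r s, DifferentiableAt ℝ (fun y => A y r s) p)
    (hB : ∀ r s, DifferentiableAt ℝ (fun y => B y r s) p) :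
    mDir e (fun y => A y * B y) p = mDir e A p * B p + A p * mDir e B p := by
  ext r s
  simp only [mDir, of_apply, Matrix.add_apply, mul_apply, Fin.sum_univ_two]
  rw [dDir_add ((hA _ _).fun_mul (hB _ _)) ((hA _ _).fun_mul (hB _ _)), dDir_mul (hA _ _) (hB _ _),
    dDir_mul (hA _ _) (hB _ _)]
  ring

lemma mDir_congr {e p : ℝ × ℝ} {A B : ℝ × ℝ → Matrix (Fin 2) (Fin 2) ℂ}
    (h : A =ᶠ[𝓝 p] B) : mDir e A p = mDir e B p := by
  ext r s
  exact dDir_congr (h.mono fun y hy => by simp only [hy])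

/-! ### Smoothness of the Darboux coefficients -/

section Coeff

variable {N : ℕ} {lam : ℕ → ℂ} {Φ : ℕ → ℝ × ℝ → Fin 2 → ℂ} {D : Set (ℝ × ℝ)}

lemma contDiffOn_wMat (hΦ : ∀ j < 2 * N, ∀ s, ContDiffOn ℝ ∞ (fun p => Φ j p s) D)
    (j c : Fin (2 * N)) : ContDiffOn ℝ ∞ (fun p => wMat N lam (vals Φ p) j c) D :=
  contDiffOn_const.mul (hΦ j j.2 _)

lemma contDiffOn_wDet (hΦ : ∀ j < 2 * N, ∀ s, ContDiffOn ℝ ∞ (fun p => Φ j p s) D) :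
    ContDiffOn ℝ ∞ (wDet N lam Φ) D :=
  contDiffOn_det (contDiffOn_wMat hΦ)

lemma isOpen_regSet (hD : IsOpen D)
    (hΦ : ∀ j < 2 * N, ∀ s, ContDiffOn ℝ ∞ (fun p => Φ j p s) D) :
    IsOpen (regSet N lam Φ D) :=
  (contDiffOn_wDet hΦ).continuousOn.isOpen_inter_preimage hD isOpen_compl_singleton

lemma regSet_subset : regSet N lam Φ D ⊆ D := fun _ h => h.1

lemma contDiffOn_dtCoeff (hΦ : ∀ j < 2 * N, ∀ s, ContDiffOn ℝ ∞ (fun p => Φ j p s) D)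
    (i : ℕ) (r s : Fin 2) :
    ContDiffOn ℝ ∞ (fun p => dtCoeff N lam (vals Φ p) i r s) (regSet N lam Φ D) := by
  simp only [dtCoeff, of_apply, div_eq_mul_inv]
  refine ContDiffOn.mul ?_
    (((contDiffOn_wDet hΦ).mono regSet_subset).inv fun p hp => hp.2)
  refine (contDiffOn_det fun j c => ?_).neg
  simp only [wRepl, of_apply]
  split_ifs
  · exact contDiffOn_const.mul ((hΦ j j.2 _).mono regSet_subset)
  · exact (contDiffOn_wMat hΦ j c).mono regSet_subset

/-- Differentiating `T_N(λ_j) Φ_j = 0`. -/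
lemma sum_mDir_dtCoeff_mulVec (hD : IsOpen D)
    (hΦ : ∀ j < 2 * N, ∀ s, ContDiffOn ℝ ∞ (fun p => Φ j p s) D) {p : ℝ × ℝ}
    (hp : p ∈ regSet N lam Φ D) (e : ℝ × ℝ) {j : ℕ} (hj : j < 2 * N) :
    (∑ i ∈ range N, lam j ^ i • mDir e (fun y => dtCoeff N lam (vals Φ y) i) p).mulVec (Φ j p)
      + (dtMat N lam (vals Φ p) (lam j)).mulVec (fun s => dDir e (fun y => Φ j y s) p) = 0 := by
  have hO := isOpen_regSet (lam := lam) hD hΦ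
  have hC : ∀ i r s, DifferentiableAt ℝ (fun y => dtCoeff N lam (vals Φ y) i r s) p :=
    fun i r s => differentiableAt_of_smooth hO (contDiffOn_dtCoeff hΦ i r s) hp
  have hF : ∀ s, DifferentiableAt ℝ (fun y => Φ j y s) p :=
    fun s => differentiableAt_of_smooth hD (hΦ j hj s) hp.1
  funext r
  have h0 : dDir e (fun y => lam j ^ N * Φ j y r + ∑ i ∈ range N, lam j ^ i *
      (dtCoeff N lam (vals Φ y) i r 0 * Φ j y 0 + dtCoeff N lam (vals Φ y) i r 1 * Φ j y 1)) p
      = 0 := by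
    rw [dDir_congr (g := fun _ => 0), dDir_const]
    filter_upwards [hO.mem_nhds hp] with y hy
    have := congrFun (dtMat_mulVec_eq_zero (F := vals Φ y) hy.2 hj) r
    rw [dtMat_eq_monicPoly, monicPoly_mulVec_apply] at this
    simpa [dotProduct, Fin.sum_univ_two, vals] using this
  have hCF : ∀ i s, DifferentiableAt ℝ
      (fun y => dtCoeff N lam (vals Φ y) i r s * Φ j y s) p := fun i s => (hC i r s).fun_mul (hF s)
  have hCF2 : ∀ i, DifferentiableAt ℝ
      (fun y => dtCoeff N lam (vals Φ y) i r 0 * Φ j y 0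
        + dtCoeff N lam (vals Φ y) i r 1 * Φ j y 1) p := fun i => (hCF i 0).fun_add (hCF i 1)
  rw [dDir_add ((differentiableAt_const _).fun_mul (hF r))
      (DifferentiableAt.fun_sum fun i _ => (differentiableAt_const _).fun_mul (hCF2 i)),
    dDir_sum _ (fun i _ => (differentiableAt_const _).fun_mul (hCF2 i)),
    dDir_const_mul _ (hF r)] at h0
  rw [Pi.add_apply, sum_smul_mulVec_apply, dtMat_eq_monicPoly, monicPoly_mulVec_apply,
    Pi.zero_apply, ← h0, add_left_comm, ← sum_add_distrib]
  congr 1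
  refine sum_congr rfl fun i _ => ?_
  rw [dDir_const_mul _ (hCF2 i), dDir_add (hCF i 0) (hCF i 1), dDir_mul (hC _ _ _) (hF _),
    dDir_mul (hC _ _ _) (hF _)]
  simp only [dotProduct, Fin.sum_univ_two, mDir, of_apply]
  ring

end Coeff

/-! ### The intertwining relations, coefficient by coefficient -/

/-- The coefficients of `z` times a matrix polynomial with coefficients `C`. -/
def shiftCoeff (C : ℕ → Matrix (Fin 2) (Fin 2) ℂ) (i : ℕ) : Matrix (Fin 2) (Fin 2) ℂ :=
  if i = 0 then 0 else C (i - 1)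

lemma sum_shiftCoeff {N : ℕ} (hN : 1 ≤ N) (C : ℕ → Matrix (Fin 2) (Fin 2) ℂ) (z : ℂ) :
    ∑ i ∈ range N, z ^ i • shiftCoeff C i
      = z • ∑ i ∈ range N, z ^ i • C i - z ^ N • C (N - 1) := by
  obtain ⟨M, rfl⟩ : ∃ M, N = M + 1 := ⟨N - 1, by omega⟩
  rw [sum_range_succ', sum_range_succ (fun i => z ^ i • C i), smul_add, smul_sum]
  simp [shiftCoeff, pow_succ', smul_smul]

lemma sum_smul_mul_right (N : ℕ) (C : ℕ → Matrix (Fin 2) (Fin 2) ℂ) (A : Matrix (Fin 2) (Fin 2) ℂ)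
    (z : ℂ) : ∑ i ∈ range N, z ^ i • (C i * A) = (∑ i ∈ range N, z ^ i • C i) * A := by
  simp [Matrix.sum_mul]

lemma sum_smul_mul_left (N : ℕ) (C : ℕ → Matrix (Fin 2) (Fin 2) ℂ) (A : Matrix (Fin 2) (Fin 2) ℂ)
    (z : ℂ) : ∑ i ∈ range N, z ^ i • (A * C i) = A * ∑ i ∈ range N, z ^ i • C i := by
  simp [Matrix.mul_sum]

/-- The defect `z T_X + T Q - Q' T` has degree less than `N` for `Q' = Q + (C_{N-1})_X`. -/
lemma defect_X {N : ℕ} (hN : 1 ≤ N) (C C' : ℕ → Matrix (Fin 2) (Fin 2) ℂ)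
    (Q : Matrix (Fin 2) (Fin 2) ℂ) (z : ℂ) :
    ∑ i ∈ range N, z ^ i • (C i * Q + shiftCoeff C' i - (Q + C' (N - 1)) * C i)
      = z • ∑ i ∈ range N, z ^ i • C' i + monicPoly N C z * Q
        - (Q + C' (N - 1)) * monicPoly N C z := by
  simp only [smul_sub, smul_add, sum_sub_distrib, sum_add_distrib, sum_smul_mul_right,
    sum_smul_mul_left, sum_shiftCoeff hN, monicPoly]
  simp only [Matrix.add_mul, Matrix.mul_add, Matrix.smul_mul, Matrix.mul_smul, Matrix.one_mul,
    Matrix.mul_one, smul_add]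
  abel

/-- The Pauli matrix `σ₃`. -/
def sigma : Matrix (Fin 2) (Fin 2) ℂ := !![1, 0; 0, -1]

/-- The defect `T_T + T V - V' T` has degree less than `N` if `V = P - i z σ₃`, `V' = P' - i z σ₃`,
`P' = P - i [C_{N-1}, σ₃]`. -/
lemma defect_T {N : ℕ} (hN : 1 ≤ N) (C C' : ℕ → Matrix (Fin 2) (Fin 2) ℂ)
    (P P' : Matrix (Fin 2) (Fin 2) ℂ)
    (hP' : P' = P - Complex.I • (C (N - 1) * sigma - sigma * C (N - 1))) (z : ℂ) :
    ∑ i ∈ range N, z ^ i • (C' i + C i * P - P' * C i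
        - Complex.I • (shiftCoeff C i * sigma - sigma * shiftCoeff C i))
      = ∑ i ∈ range N, z ^ i • C' i + monicPoly N C z * (P - (z * Complex.I) • sigma)
        - (P' - (z * Complex.I) • sigma) * monicPoly N C z := by
  have h1 : ∑ i ∈ range N, z ^ i •
      (Complex.I • (shiftCoeff C i * sigma - sigma * shiftCoeff C i))
      = Complex.I • ((z • ∑ i ∈ range N, z ^ i • C i - z ^ N • C (N - 1)) * sigma
        - sigma * (z • ∑ i ∈ range N, z ^ i • C i - z ^ N • C (N - 1))) := by
    rw [← sum_shiftCoeff hN, ← sum_smul_mul_right, ← sum_smul_mul_left, ← sum_sub_distrib,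
      smul_sum]
    exact sum_congr rfl fun i _ => by rw [smul_comm, smul_sub]
  rw [eq_sub_iff_add_eq] at hP'
  rw [← hP']
  simp only [smul_sub, smul_add, sum_sub_distrib, sum_add_distrib, sum_smul_mul_right,
    sum_smul_mul_left, monicPoly] at h1 ⊢
  rw [h1]
  simp only [Matrix.add_mul, Matrix.mul_add, Matrix.smul_mul, Matrix.mul_smul, Matrix.one_mul,
    Matrix.mul_one, Matrix.sub_mul, Matrix.mul_sub, smul_smul, smul_sub, smul_add]
  module

section Pointwise

variable {N : ℕ} {lam : ℕ → ℂ} {F F' : ℕ → Fin 2 → ℂ} {C' : ℕ → Matrix (Fin 2) (Fin 2) ℂ}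
  {Q P P' : Matrix (Fin 2) (Fin 2) ℂ}

/-- The `X`-equations of the eigenfunctions at a point, `F'` and `C'` being the `X`-derivatives of
the data and of the coefficients, make all coefficients of `z T_X + T Q - Q' T` vanish. -/
lemma coeff_relation_X (hN : 1 ≤ N) (hlam : ∀ j < 2 * N, lam j ≠ 0)
    (hW : (wMat N lam F).det ≠ 0)
    (hd : ∀ j < 2 * N, (∑ i ∈ range N, lam j ^ i • C' i).mulVec (F j)
      + (dtMat N lam F (lam j)).mulVec (F' j) = 0)
    (hF' : ∀ j < 2 * N, F' j = (1 / lam j) • Q.mulVec (F j)) :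
    ∀ i < N, dtCoeff N lam F i * Q + shiftCoeff C' i
      - (Q + C' (N - 1)) * dtCoeff N lam F i = 0 := by
  refine coeff_eq_zero hW _ fun j hj => ?_
  rw [defect_X hN, ← dtMat_eq_monicPoly, sub_mulVec, ← mulVec_mulVec _ (Q + C' (N - 1)),
    dtMat_mulVec_eq_zero hW hj, mulVec_zero, sub_zero, add_mulVec, smul_mulVec,
    ← mulVec_mulVec]
  have h1 := hd j hj
  rw [hF' j hj, mulVec_smul] at h1
  rw [eq_neg_of_add_eq_zero_left h1, smul_neg, smul_smul, mul_one_div_cancel (hlam j hj), one_smul,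
    neg_add_cancel]

/-- The analogue of `coeff_relation_X` for the `T`-equations: all coefficients of
`T_T + T V - V' T` vanish. -/
lemma coeff_relation_T (hN : 1 ≤ N) (hW : (wMat N lam F).det ≠ 0)
    (hP' : P' = P - Complex.I • (dtCoeff N lam F (N - 1) * sigma
      - sigma * dtCoeff N lam F (N - 1)))
    (hd : ∀ j < 2 * N, (∑ i ∈ range N, lam j ^ i • C' i).mulVec (F j)
      + (dtMat N lam F (lam j)).mulVec (F' j) = 0)
    (hF' : ∀ j < 2 * N, F' j = (P - (lam j * Complex.I) • sigma).mulVec (F j)) :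
    ∀ i < N, C' i + dtCoeff N lam F i * P - P' * dtCoeff N lam F i
        - Complex.I • (shiftCoeff (dtCoeff N lam F) i * sigma
          - sigma * shiftCoeff (dtCoeff N lam F) i) = 0 := by
  refine coeff_eq_zero hW _ fun j hj => ?_
  rw [defect_T hN _ _ _ _ hP', ← dtMat_eq_monicPoly, sub_mulVec,
    ← mulVec_mulVec _ (P' - (lam j * Complex.I) • sigma),
    dtMat_mulVec_eq_zero hW hj, mulVec_zero, sub_zero, add_mulVec, ← mulVec_mulVec, ← hF' j hj]
  exact hd j hj

lemma intertwine_X (hN : 1 ≤ N) (C : ℕ → Matrix (Fin 2) (Fin 2) ℂ)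
    (h : ∀ i < N, C i * Q + shiftCoeff C' i - (Q + C' (N - 1)) * C i = 0) {z : ℂ} (hz : z ≠ 0) :
    ∑ i ∈ range N, z ^ i • C' i + monicPoly N C z * ((1 / z) • Q)
      = ((1 / z) • (Q + C' (N - 1))) * monicPoly N C z := by
  have h1 := defect_X hN C C' Q z
  rw [sum_eq_zero fun i hi => by rw [h i (mem_range.1 hi), smul_zero]] at h1
  rw [Matrix.smul_mul, ← sub_eq_zero.1 h1.symm, smul_add, smul_smul, one_div_mul_cancel hz,
    one_smul, Matrix.mul_smul]

lemma intertwine_T (hN : 1 ≤ N) (C : ℕ → Matrix (Fin 2) (Fin 2) ℂ)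
    (hP' : P' = P - Complex.I • (C (N - 1) * sigma - sigma * C (N - 1)))
    (h : ∀ i < N, C' i + C i * P - P' * C i
        - Complex.I • (shiftCoeff C i * sigma - sigma * shiftCoeff C i) = 0) (z : ℂ) :
    ∑ i ∈ range N, z ^ i • C' i + monicPoly N C z * (P - (z * Complex.I) • sigma)
      = (P' - (z * Complex.I) • sigma) * monicPoly N C z := by
  have h1 := defect_T hN C C' P P' hP' z
  rw [sum_eq_zero fun i hi => by rw [h i (mem_range.1 hi), smul_zero]] at h1
  exact sub_eq_zero.1 h1.symm

end Pointwise

/-! ### The Lax matrices -/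

lemma laxU_eq (u v ρ : ℝ × ℝ → ℂ) (z : ℂ) (p : ℝ × ℝ) :
    laxU u v ρ z p = (1 / z) • laxU u v ρ 1 p := by
  simp only [laxU, smul_smul]
  congr 1
  rcases eq_or_ne z 0 with rfl | hz
  · simp
  · field_simp

lemma laxV_eq (u v : ℝ × ℝ → ℂ) (z : ℂ) (p : ℝ × ℝ) :
    laxV u v z p = laxV u v 0 p - (z * Complex.I) • sigma := by
  ext r s
  fin_cases r <;> fin_cases s <;> simp [laxV, sigma, mul_comm]

lemma laxV_zero (u v : ℝ × ℝ → ℂ) (p : ℝ × ℝ) : laxV u v 0 p = !![0, u p; v p, 0] := by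
  simp [laxV]

lemma laxU_one (u v ρ : ℝ × ℝ → ℂ) (p : ℝ × ℝ) :
    laxU u v ρ 1 p = !![-Complex.I / 2 * ρ p, -Complex.I / 2 * dFst u p;
      Complex.I / 2 * dFst v p, Complex.I / 2 * ρ p] := by
  ext r s
  fin_cases r <;> fin_cases s <;> simp [laxU] <;> ring

/-- The zero curvature equation `Q_T = [P, Q]` at order `1/z`, in terms of the potentials; the
matrices `Q` and `P` are `laxU` at `l = 1` and `laxV` at `l = 0`. -/
lemma zeroCurvature_iff {u v ρ : ℝ × ℝ → ℂ} {D : Set (ℝ × ℝ)} (hD : IsOpen D)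
    (hu : ContDiffOn ℝ ∞ u D) (hv : ContDiffOn ℝ ∞ v D) (hρ : ContDiffOn ℝ ∞ ρ D) {p : ℝ × ℝ}
    (hp : p ∈ D) :
    mDir (0, 1) (laxU u v ρ 1) p
        = laxV u v 0 p * laxU u v ρ 1 p - laxU u v ρ 1 p * laxV u v 0 p ↔
      dSnd (dFst u) p = -2 * u p * ρ p ∧ dSnd (dFst v) p = -2 * v p * ρ p ∧
        dSnd ρ p = -dFst (fun s => u s * v s) p := by
  have du := differentiableAt_of_smooth hD hu hp
  have dv := differentiableAt_of_smooth hD hv hp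
  have dρ := differentiableAt_of_smooth hD hρ hp
  have dux := differentiableAt_of_smooth hD (contDiffOn_dFst hD hu) hp
  have dvx := differentiableAt_of_smooth hD (contDiffOn_dFst hD hv) hp
  have huv : dFst (fun s => u s * v s) p = dFst u p * v p + u p * dFst v p := by
    rw [dFst_eq_dDir (du.fun_mul dv), dDir_mul du dv, dFst_eq_dDir du, dFst_eq_dDir dv]
  rw [huv, dSnd_eq_dDir dux, dSnd_eq_dDir dvx, dSnd_eq_dDir dρ]
  have hI : Complex.I ≠ 0 := Complex.I_ne_zero
  have hm : mDir (0, 1) (laxU u v ρ 1) p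
      = !![-Complex.I / 2 * dDir (0, 1) ρ p, -Complex.I / 2 * dDir (0, 1) (dFst u) p;
        Complex.I / 2 * dDir (0, 1) (dFst v) p, Complex.I / 2 * dDir (0, 1) ρ p] := by
    ext r s
    fin_cases r <;> fin_cases s <;>
      simp [mDir, laxU_one, dDir_const_mul, dρ, dux, dvx]
  rw [hm, laxV_zero, laxU_one]
  constructor
  · intro h
    have h01 := congrFun (congrFun h 0) 1
    have h10 := congrFun (congrFun h 1) 0
    have h11 := congrFun (congrFun h 1) 1
    simp at h01 h10 h11
    refine ⟨?_, ?_, ?_⟩ <;> apply mul_left_cancel₀ hI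
    · linear_combination -2 * h01
    · linear_combination 2 * h10
    · linear_combination 2 * h11
  · rintro ⟨h1, h2, h3⟩
    rw [h1, h2, h3]
    ext r s
    fin_cases r <;> fin_cases s <;> simp <;> ring

/-! ### The seed -/

section Seed

variable {D : Set (ℝ × ℝ)} {u v ρ : ℝ × ℝ → ℂ}

/-- The equation `v_XT = -2vρ` follows from the compatibility of the two equations of the Lax pair
for the component `ψ`, at points where `φ ≠ 0`. (It is not a consequence of the other equations of
the seed, as `ρ` is not assumed to be even.) -/
lemma eqn_v_of_eigenfunction (hs : IsPlaneNonlocalSolution u v ρ D) {l : ℂ} (hl : l ≠ 0)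
    {Φ : ℝ × ℝ → Fin 2 → ℂ} (hΦ : IsEigenfunction u v ρ l Φ D) {p : ℝ × ℝ} (hp : p ∈ D)
    (h0 : Φ p 0 ≠ 0) : dSnd (dFst v) p = -2 * v p * ρ p := by
  have hD := hs.isOpen
  have du := differentiableAt_of_smooth hD hs.smooth_u hp
  have dv := differentiableAt_of_smooth hD hs.smooth_v hp
  have dρ := differentiableAt_of_smooth hD hs.smooth_ρ hp
  have dvx := differentiableAt_of_smooth hD (contDiffOn_dFst hD hs.smooth_v) hp
  have d0 := differentiableAt_of_smooth hD (hΦ.smooth 0) hp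
  have d1 := differentiableAt_of_smooth hD (hΦ.smooth 1) hp
  have hX : ∀ y ∈ D, dFst (fun s => Φ s 0) y = 1 / (2 * l) * (-Complex.I * ρ y * Φ y 0
        - Complex.I * dFst u y * Φ y 1) ∧
      dFst (fun s => Φ s 1) y = 1 / (2 * l) * (Complex.I * dFst v y * Φ y 0
        + Complex.I * ρ y * Φ y 1) := by
    intro y hy
    have h := hΦ.eqn_X y hy
    have e0 := congrFun h 0
    have e1 := congrFun h 1
    simp [laxU, mulVec, dotProduct, Fin.sum_univ_two] at e0 e1
    rw [e0, e1]
    constructor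
    · field_simp
      ring
    · field_simp
  have hT : ∀ y ∈ D, dSnd (fun s => Φ s 0) y = -Complex.I * l * Φ y 0 + u y * Φ y 1 ∧
      dSnd (fun s => Φ s 1) y = v y * Φ y 0 + Complex.I * l * Φ y 1 := by
    intro y hy
    have h := hΦ.eqn_T y hy
    have e0 := congrFun h 0
    have e1 := congrFun h 1
    simp [laxV, mulVec, dotProduct, Fin.sum_univ_two] at e0 e1
    rw [e0, e1]
    constructor <;> ring
  have hc := dSnd_dFst_comm hD (hΦ.smooth 1) hp
  have hnhds := hD.mem_nhds hp
  have dA : DifferentiableAt ℝ (fun y => Complex.I * dFst v y * Φ y 0) p :=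
    ((differentiableAt_const _).fun_mul dvx).fun_mul d0
  have dB : DifferentiableAt ℝ (fun y => Complex.I * ρ y * Φ y 1) p :=
    ((differentiableAt_const _).fun_mul dρ).fun_mul d1
  rw [dSnd_congr (g := fun y => 1 / (2 * l) * (Complex.I * dFst v y * Φ y 0
        + Complex.I * ρ y * Φ y 1)) (by filter_upwards [hnhds] with y hy; exact (hX y hy).2),
    dFst_congr (g := fun y => v y * Φ y 0 + Complex.I * l * Φ y 1)
      (by filter_upwards [hnhds] with y hy; exact (hT y hy).2),
    dSnd_eq_dDir ((differentiableAt_const _).fun_mul (dA.fun_add dB)),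
    dFst_eq_dDir ((dv.fun_mul d0).fun_add ((differentiableAt_const _).fun_mul d1)),
    dDir_const_mul _ (dA.fun_add dB), dDir_add dA dB,
    dDir_mul ((differentiableAt_const _).fun_mul dvx) d0,
    dDir_mul ((differentiableAt_const _).fun_mul dρ) d1, dDir_const_mul _ dvx,
    dDir_const_mul _ dρ, dDir_add (dv.fun_mul d0) ((differentiableAt_const _).fun_mul d1),
    dDir_mul dv d0, dDir_const_mul _ d1, ← dSnd_eq_dDir d0, ← dSnd_eq_dDir d1,
    ← dFst_eq_dDir d0, ← dFst_eq_dDir d1, (hX p hp).1, (hX p hp).2, (hT p hp).1, (hT p hp).2,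
    ← dSnd_eq_dDir dvx, ← dSnd_eq_dDir dρ, hs.eqn_ρ p hp, dFst_eq_dDir (du.fun_mul dv),
    dDir_mul du dv, ← dFst_eq_dDir du, ← dFst_eq_dDir dv] at hc
  apply mul_right_cancel₀ (mul_ne_zero Complex.I_ne_zero h0)
  field_simp at hc
  linear_combination hc + 2 * Φ p 0 * l * dFst v p * Complex.I_sq

/-- The zero curvature equation for the seed, at the points of `Ω`. -/
lemma seed_zeroCurvature (hs : IsPlaneNonlocalSolution u v ρ D) {N : ℕ} (hN : 1 ≤ N)
    {lam : ℕ → ℂ} (hlam : ∀ j < 2 * N, lam j ≠ 0) {Φ : ℕ → ℝ × ℝ → Fin 2 → ℂ}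
    (hΦ : ∀ j < 2 * N, IsEigenfunction u v ρ (lam j) (Φ j) D) {p : ℝ × ℝ}
    (hp : p ∈ regSet N lam Φ D) :
    mDir (0, 1) (laxU u v ρ 1) p
      = laxV u v 0 p * laxU u v ρ 1 p - laxU u v ρ 1 p * laxV u v 0 p := by
  rw [zeroCurvature_iff hs.isOpen hs.smooth_u hs.smooth_v hs.smooth_ρ hp.1]
  refine ⟨hs.eqn_u p hp.1, ?_, hs.eqn_ρ p hp.1⟩
  -- Otherwise the first column of `W_N` would be zero.
  obtain ⟨j, hj, h0⟩ : ∃ j < 2 * N, Φ j p 0 ≠ 0 := by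
    by_contra! h
    refine hp.2 (det_eq_zero_of_column_eq_zero ⟨0, by omega⟩ fun j => ?_)
    simp [wMat, vals, h j j.2]
  exact eqn_v_of_eigenfunction hs (hlam j hj) (hΦ j hj) hp.1 h0

end Seed

/-! ### The transformed potentials -/

section Darboux

variable {D : Set (ℝ × ℝ)} {u v ρ : ℝ × ℝ → ℂ} {N : ℕ} {lam : ℕ → ℂ}
  {Φ : ℕ → ℝ × ℝ → Fin 2 → ℂ}

/-- The coefficients of `T_N` as functions on the `(X,T)`-plane. -/
noncomputable def coeffFun (N : ℕ) (lam : ℕ → ℂ) (Φ : ℕ → ℝ × ℝ → Fin 2 → ℂ) (i : ℕ) (p : ℝ × ℝ) :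
    Matrix (Fin 2) (Fin 2) ℂ := dtCoeff N lam (vals Φ p) i

lemma uNew_eq : uNew u N lam Φ = fun p => u p + 2 * Complex.I * coeffFun N lam Φ (N - 1) p 0 1 :=
  rfl

lemma vNew_eq : vNew v N lam Φ = fun p => v p - 2 * Complex.I * coeffFun N lam Φ (N - 1) p 1 0 :=
  rfl

lemma ρNew_eq : ρNew ρ N lam Φ
    = fun p => ρ p + 2 * Complex.I * dFst (fun s => coeffFun N lam Φ (N - 1) s 0 0) p :=
  rfl

lemma xNew_eq (x₀ : ℝ × ℝ → ℂ) : xNew x₀ N lam Φ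
    = fun p => x₀ p + 2 * Complex.I * coeffFun N lam Φ (N - 1) p 0 0 :=
  rfl

lemma contDiffOn_coeffFun (hΦ : ∀ j < 2 * N, ∀ s, ContDiffOn ℝ ∞ (fun p => Φ j p s) D)
    (i : ℕ) (r s : Fin 2) :
    ContDiffOn ℝ ∞ (fun p => coeffFun N lam Φ i p r s) (regSet N lam Φ D) :=
  contDiffOn_dtCoeff hΦ i r s

lemma contDiffOn_uNew (hΦ : ∀ j < 2 * N, ∀ s, ContDiffOn ℝ ∞ (fun p => Φ j p s) D)
    (hu : ContDiffOn ℝ ∞ u D) : ContDiffOn ℝ ∞ (uNew u N lam Φ) (regSet N lam Φ D) :=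
  (hu.mono regSet_subset).add (contDiffOn_const.mul (contDiffOn_coeffFun hΦ _ _ _))

lemma contDiffOn_vNew (hΦ : ∀ j < 2 * N, ∀ s, ContDiffOn ℝ ∞ (fun p => Φ j p s) D)
    (hv : ContDiffOn ℝ ∞ v D) : ContDiffOn ℝ ∞ (vNew v N lam Φ) (regSet N lam Φ D) :=
  (hv.mono regSet_subset).sub (contDiffOn_const.mul (contDiffOn_coeffFun hΦ _ _ _))

lemma contDiffOn_ρNew (hD : IsOpen D)
    (hΦ : ∀ j < 2 * N, ∀ s, ContDiffOn ℝ ∞ (fun p => Φ j p s) D)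
    (hρ : ContDiffOn ℝ ∞ ρ D) : ContDiffOn ℝ ∞ (ρNew ρ N lam Φ) (regSet N lam Φ D) :=
  (hρ.mono regSet_subset).add (contDiffOn_const.mul
    (contDiffOn_dFst (isOpen_regSet hD hΦ) (contDiffOn_coeffFun hΦ _ _ _)))

lemma contDiffOn_xNew (hΦ : ∀ j < 2 * N, ∀ s, ContDiffOn ℝ ∞ (fun p => Φ j p s) D)
    {x₀ : ℝ × ℝ → ℂ} (hx : ContDiffOn ℝ ∞ x₀ D) :
    ContDiffOn ℝ ∞ (xNew x₀ N lam Φ) (regSet N lam Φ D) :=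
  (hx.mono regSet_subset).add (contDiffOn_const.mul (contDiffOn_coeffFun hΦ _ _ _))

lemma coeffFun_differentiableAt (hD : IsOpen D)
    (hΦ : ∀ j < 2 * N, ∀ s, ContDiffOn ℝ ∞ (fun p => Φ j p s) D) {p : ℝ × ℝ}
    (hp : p ∈ regSet N lam Φ D) (i : ℕ) (r s : Fin 2) :
    DifferentiableAt ℝ (fun y => coeffFun N lam Φ i y r s) p :=
  differentiableAt_of_smooth (isOpen_regSet hD hΦ) (contDiffOn_coeffFun hΦ i r s) hp

/-- `U^[N] = U + (C_{N-1})_X / z`. The trace of `C_{N-1}` being constant, the two diagonal entries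
agree with one function `ρ^[N]`. -/
lemma laxU_new (hN : 1 ≤ N) (hD : IsOpen D) (hu : ContDiffOn ℝ ∞ u D) (hv : ContDiffOn ℝ ∞ v D)
    (hΦ : ∀ j < 2 * N, ∀ s, ContDiffOn ℝ ∞ (fun p => Φ j p s) D) {p : ℝ × ℝ}
    (hp : p ∈ regSet N lam Φ D) :
    laxU (uNew u N lam Φ) (vNew v N lam Φ) (ρNew ρ N lam Φ) 1 p
      = laxU u v ρ 1 p + mDir (1, 0) (coeffFun N lam Φ (N - 1)) p := by
  have dC := fun r s => coeffFun_differentiableAt hD hΦ hp (N - 1) r s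
  have du := differentiableAt_of_smooth hD hu hp.1
  have dv := differentiableAt_of_smooth hD hv hp.1
  have htr : dDir (1, 0) (fun y => coeffFun N lam Φ (N - 1) y 0 0) p
      + dDir (1, 0) (fun y => coeffFun N lam Φ (N - 1) y 1 1) p = 0 := by
    rw [← dDir_add (dC 0 0) (dC 1 1), ← dDir_const (e := (1, 0)) (p := p)
      (-∑ j ∈ range (2 * N), lam j)]
    refine dDir_congr ?_
    filter_upwards [(isOpen_regSet hD hΦ).mem_nhds hp] with y hy
    exact dtCoeff_trace hN hy.2
  have h1 : dFst (uNew u N lam Φ) p = dFst u p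
      + 2 * Complex.I * dDir (1, 0) (fun y => coeffFun N lam Φ (N - 1) y 0 1) p := by
    rw [uNew_eq, dFst_eq_dDir (du.fun_add ((differentiableAt_const _).fun_mul (dC 0 1))),
      dDir_add du ((differentiableAt_const _).fun_mul (dC 0 1)), dDir_const_mul _ (dC 0 1),
      dFst_eq_dDir du]
  have h2 : dFst (vNew v N lam Φ) p = dFst v p
      - 2 * Complex.I * dDir (1, 0) (fun y => coeffFun N lam Φ (N - 1) y 1 0) p := by
    rw [vNew_eq, dFst_eq_dDir (dv.fun_sub ((differentiableAt_const _).fun_mul (dC 1 0))),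
      dDir_sub dv ((differentiableAt_const _).fun_mul (dC 1 0)), dDir_const_mul _ (dC 1 0),
      dFst_eq_dDir dv]
  have h3 : ρNew ρ N lam Φ p = ρ p
      + 2 * Complex.I * dDir (1, 0) (fun y => coeffFun N lam Φ (N - 1) y 0 0) p := by
    simp only [ρNew_eq]
    rw [dFst_eq_dDir (dC 0 0)]
  rw [laxU_one, laxU_one, h1, h2, h3]
  ext r s
  fin_cases r <;> fin_cases s <;> simp [mDir]
  · linear_combination -dDir (1, 0) (fun y => coeffFun N lam Φ (N - 1) y 0 0) p * Complex.I_sq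
  · linear_combination -dDir (1, 0) (fun y => coeffFun N lam Φ (N - 1) y 0 1) p * Complex.I_sq
  · linear_combination -dDir (1, 0) (fun y => coeffFun N lam Φ (N - 1) y 1 0) p * Complex.I_sq
  · linear_combination dDir (1, 0) (fun y => coeffFun N lam Φ (N - 1) y 0 0) p * Complex.I_sq
      - htr

lemma laxV_new (p : ℝ × ℝ) :
    laxV (uNew u N lam Φ) (vNew v N lam Φ) 0 p
      = laxV u v 0 p - Complex.I • (coeffFun N lam Φ (N - 1) p * sigma
        - sigma * coeffFun N lam Φ (N - 1) p) := by
  rw [laxV_zero, laxV_zero, uNew_eq, vNew_eq]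
  ext r s
  fin_cases r <;> fin_cases s <;> simp [sigma, mul_apply, Fin.sum_univ_two, vecMul, dotProduct] <;> ring

variable (hN : 1 ≤ N) (hlam : ∀ j < 2 * N, lam j ≠ 0) (hs : IsPlaneNonlocalSolution u v ρ D)
  (hΦ : ∀ j < 2 * N, IsEigenfunction u v ρ (lam j) (Φ j) D)

include hN hlam hs hΦ in
lemma coeffFun_relation_X {p : ℝ × ℝ} (hp : p ∈ regSet N lam Φ D) :
    ∀ i < N, coeffFun N lam Φ i p * laxU u v ρ 1 p
      + shiftCoeff (fun i => mDir (1, 0) (coeffFun N lam Φ i) p) i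
      - (laxU u v ρ 1 p + mDir (1, 0) (coeffFun N lam Φ (N - 1)) p) * coeffFun N lam Φ i p
      = 0 := by
  have hΦs : ∀ j < 2 * N, ∀ s, ContDiffOn ℝ ∞ (fun p => Φ j p s) D := fun j hj => (hΦ j hj).smooth
  refine coeff_relation_X hN hlam hp.2
    (fun j hj => sum_mDir_dtCoeff_mulVec hs.isOpen hΦs hp (1, 0) hj) fun j hj => ?_
  rw [← smul_mulVec, ← laxU_eq, vals, ← (hΦ j hj).eqn_X p hp.1]
  funext s
  exact (dFst_eq_dDir (differentiableAt_of_smooth hs.isOpen (hΦs j hj s) hp.1)).symm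

include hN hs hΦ in
lemma coeffFun_relation_T {p : ℝ × ℝ} (hp : p ∈ regSet N lam Φ D) :
    ∀ i < N, mDir (0, 1) (coeffFun N lam Φ i) p + coeffFun N lam Φ i p * laxV u v 0 p
      - laxV (uNew u N lam Φ) (vNew v N lam Φ) 0 p * coeffFun N lam Φ i p
      - Complex.I • (shiftCoeff (fun i => coeffFun N lam Φ i p) i * sigma
          - sigma * shiftCoeff (fun i => coeffFun N lam Φ i p) i) = 0 := by
  have hΦs : ∀ j < 2 * N, ∀ s, ContDiffOn ℝ ∞ (fun p => Φ j p s) D := fun j hj => (hΦ j hj).smooth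
  refine coeff_relation_T hN hp.2 (laxV_new p)
    (fun j hj => sum_mDir_dtCoeff_mulVec hs.isOpen hΦs hp (0, 1) hj) fun j hj => ?_
  rw [← laxV_eq, vals, ← (hΦ j hj).eqn_T p hp.1]
  funext s
  exact (dSnd_eq_dDir (differentiableAt_of_smooth hs.isOpen (hΦs j hj s) hp.1)).symm

lemma dtMat_apply (z : ℂ) (y : ℝ × ℝ) (r s : Fin 2) : dtMat N lam (vals Φ y) z r s
    = z ^ N * (1 : Matrix (Fin 2) (Fin 2) ℂ) r s
      + ∑ i ∈ range N, z ^ i * coeffFun N lam Φ i y r s := by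
  simp [dtMat, Matrix.sum_apply, coeffFun]

lemma contDiffOn_dtMat (hΦ : ∀ j < 2 * N, ∀ s, ContDiffOn ℝ ∞ (fun p => Φ j p s) D) (z : ℂ)
    (r s : Fin 2) :
    ContDiffOn ℝ ∞ (fun y => dtMat N lam (vals Φ y) z r s) (regSet N lam Φ D) := by
  simp only [dtMat_apply]
  exact contDiffOn_const.add (ContDiffOn.sum fun i _ =>
    contDiffOn_const.mul (contDiffOn_coeffFun hΦ i r s))

lemma mDir_dtMat (hD : IsOpen D) (hΦ : ∀ j < 2 * N, ∀ s, ContDiffOn ℝ ∞ (fun p => Φ j p s) D)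
    {p : ℝ × ℝ} (hp : p ∈ regSet N lam Φ D) (e : ℝ × ℝ) (z : ℂ) :
    mDir e (fun y => dtMat N lam (vals Φ y) z) p
      = ∑ i ∈ range N, z ^ i • mDir e (coeffFun N lam Φ i) p := by
  ext r s
  have dC := fun i r s => coeffFun_differentiableAt hD hΦ hp i r s
  simp only [mDir, of_apply, dtMat_apply, Matrix.sum_apply, Matrix.smul_apply, smul_eq_mul]
  rw [dDir_add (differentiableAt_const _) (DifferentiableAt.fun_sum fun i _ =>
      (differentiableAt_const _).fun_mul (dC i r s)), dDir_const, zero_add,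
    dDir_sum _ fun i _ => (differentiableAt_const _).fun_mul (dC i r s)]
  exact sum_congr rfl fun i _ => dDir_const_mul _ (dC i r s)

include hN hlam hs hΦ in
/-- `T_X + T U = U^[N] T`. -/
lemma darboux_X {z : ℂ} (hz : z ≠ 0) {p : ℝ × ℝ} (hp : p ∈ regSet N lam Φ D) :
    mDir (1, 0) (fun y => dtMat N lam (vals Φ y) z) p + dtMat N lam (vals Φ p) z * laxU u v ρ z p
      = laxU (uNew u N lam Φ) (vNew v N lam Φ) (ρNew ρ N lam Φ) z p
        * dtMat N lam (vals Φ p) z := by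
  have hΦs : ∀ j < 2 * N, ∀ s, ContDiffOn ℝ ∞ (fun p => Φ j p s) D := fun j hj => (hΦ j hj).smooth
  rw [mDir_dtMat hs.isOpen hΦs hp, laxU_eq u, laxU_eq (uNew u N lam Φ),
    laxU_new hN hs.isOpen hs.smooth_u hs.smooth_v hΦs hp]
  exact intertwine_X hN (fun i => coeffFun N lam Φ i p)
    (coeffFun_relation_X hN hlam hs hΦ hp) hz

include hN hs hΦ in
/-- `T_T + T V = V^[N] T`. -/
lemma darboux_T (z : ℂ) {p : ℝ × ℝ} (hp : p ∈ regSet N lam Φ D) :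
    mDir (0, 1) (fun y => dtMat N lam (vals Φ y) z) p + dtMat N lam (vals Φ p) z * laxV u v z p
      = laxV (uNew u N lam Φ) (vNew v N lam Φ) z p * dtMat N lam (vals Φ p) z := by
  have hΦs : ∀ j < 2 * N, ∀ s, ContDiffOn ℝ ∞ (fun p => Φ j p s) D := fun j hj => (hΦ j hj).smooth
  rw [mDir_dtMat hs.isOpen hΦs hp, laxV_eq u, laxV_eq (uNew u N lam Φ)]
  exact intertwine_T hN (fun i => coeffFun N lam Φ i p) (laxV_new p)
    (coeffFun_relation_T hN hs hΦ hp) z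

lemma dFst_dtMat (hD : IsOpen D) (hΦ : ∀ j < 2 * N, ∀ s, ContDiffOn ℝ ∞ (fun p => Φ j p s) D)
    {p : ℝ × ℝ} (hp : p ∈ regSet N lam Φ D) (z : ℂ) :
    Matrix.of (fun r s => dFst (fun y => dtMat N lam (vals Φ y) z r s) p)
      = mDir (1, 0) (fun y => dtMat N lam (vals Φ y) z) p := by
  ext r s
  exact dFst_eq_dDir (differentiableAt_of_smooth (isOpen_regSet hD hΦ)
    (contDiffOn_dtMat hΦ z r s) hp)

lemma dSnd_dtMat (hD : IsOpen D) (hΦ : ∀ j < 2 * N, ∀ s, ContDiffOn ℝ ∞ (fun p => Φ j p s) D)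
    {p : ℝ × ℝ} (hp : p ∈ regSet N lam Φ D) (z : ℂ) :
    Matrix.of (fun r s => dSnd (fun y => dtMat N lam (vals Φ y) z r s) p)
      = mDir (0, 1) (fun y => dtMat N lam (vals Φ y) z) p := by
  ext r s
  exact dSnd_eq_dDir (differentiableAt_of_smooth (isOpen_regSet hD hΦ)
    (contDiffOn_dtMat hΦ z r s) hp)

lemma dDir_mulVec {e p : ℝ × ℝ} {A : ℝ × ℝ → Matrix (Fin 2) (Fin 2) ℂ} {f : ℝ × ℝ → Fin 2 → ℂ}
    (hA : ∀ r s, DifferentiableAt ℝ (fun y => A y r s) p)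
    (hf : ∀ s, DifferentiableAt ℝ (fun y => f y s) p) (r : Fin 2) :
    dDir e (fun y => (A y).mulVec (f y) r) p
      = (mDir e A p).mulVec (f p) r + (A p).mulVec (fun s => dDir e (fun y => f y s) p) r := by
  simp only [mDir, of_apply, mulVec, dotProduct, Fin.sum_univ_two]
  rw [dDir_add ((hA _ _).fun_mul (hf _)) ((hA _ _).fun_mul (hf _)), dDir_mul (hA _ _) (hf _),
    dDir_mul (hA _ _) (hf _)]
  ring

include hN hlam hs hΦ in
lemma isEigenfunction_new {z : ℂ} (hz : z ≠ 0) {Ψ : ℝ × ℝ → Fin 2 → ℂ}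
    (hΨ : IsEigenfunction u v ρ z Ψ D) :
    IsEigenfunction (uNew u N lam Φ) (vNew v N lam Φ) (ρNew ρ N lam Φ) z
      (fun p => (dtMat N lam (vals Φ p) z).mulVec (Ψ p)) (regSet N lam Φ D) := by
  have hΦs : ∀ j < 2 * N, ∀ s, ContDiffOn ℝ ∞ (fun p => Φ j p s) D := fun j hj => (hΦ j hj).smooth
  have hO := isOpen_regSet (lam := lam) hs.isOpen hΦs
  have hsm : ∀ i, ContDiffOn ℝ ∞ (fun p => (dtMat N lam (vals Φ p) z).mulVec (Ψ p) i)
      (regSet N lam Φ D) := fun i => by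
    simp only [mulVec, dotProduct]
    exact ContDiffOn.sum fun s _ =>
      (contDiffOn_dtMat hΦs z i s).mul ((hΨ.smooth s).mono regSet_subset)
  have dT : ∀ p ∈ regSet N lam Φ D, ∀ r s,
      DifferentiableAt ℝ (fun y => dtMat N lam (vals Φ y) z r s) p := fun p hp r s =>
    differentiableAt_of_smooth hO (contDiffOn_dtMat hΦs z r s) hp
  have dΨ : ∀ p ∈ regSet N lam Φ D, ∀ s, DifferentiableAt ℝ (fun y => Ψ y s) p := fun p hp s =>
    differentiableAt_of_smooth hs.isOpen (hΨ.smooth s) hp.1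
  refine ⟨hsm, fun p hp => ?_, fun p hp => ?_⟩
  · have h : (fun s => dDir (1, 0) (fun y => Ψ y s) p) = (laxU u v ρ z p).mulVec (Ψ p) := by
      rw [← hΨ.eqn_X p hp.1]
      exact funext fun s => (dFst_eq_dDir (dΨ p hp s)).symm
    rw [mulVec_mulVec, ← darboux_X hN hlam hs hΦ hz hp, add_mulVec, ← mulVec_mulVec, ← h]
    funext r
    rw [dFst_eq_dDir (differentiableAt_of_smooth hO (hsm r) hp), dDir_mulVec (dT p hp) (dΨ p hp)]
    rfl
  · have h : (fun s => dDir (0, 1) (fun y => Ψ y s) p) = (laxV u v z p).mulVec (Ψ p) := by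
      rw [← hΨ.eqn_T p hp.1]
      exact funext fun s => (dSnd_eq_dDir (dΨ p hp s)).symm
    rw [mulVec_mulVec, ← darboux_T hN hs hΦ z hp, add_mulVec, ← mulVec_mulVec, ← h]
    funext r
    rw [dSnd_eq_dDir (differentiableAt_of_smooth hO (hsm r) hp), dDir_mulVec (dT p hp) (dΨ p hp)]
    rfl

include hN hlam hs hΦ in
/-- The constant coefficient of the `X`-relation: `T_N(0)` conjugates `z U` to `z U^[N]`. -/
lemma coeffFun_zero_mul_laxU {p : ℝ × ℝ} (hp : p ∈ regSet N lam Φ D) :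
    coeffFun N lam Φ 0 p * laxU u v ρ 1 p
      = laxU (uNew u N lam Φ) (vNew v N lam Φ) (ρNew ρ N lam Φ) 1 p * coeffFun N lam Φ 0 p := by
  have h := coeffFun_relation_X hN hlam hs hΦ hp 0 (by omega)
  rw [laxU_new hN hs.isOpen hs.smooth_u hs.smooth_v (fun j hj => (hΦ j hj).smooth) hp]
  rw [shiftCoeff, if_pos rfl, add_zero] at h
  exact sub_eq_zero.1 h

include hN hs hΦ in
/-- The constant coefficient of the `T`-relation. -/
lemma mDir_coeffFun_zero {p : ℝ × ℝ} (hp : p ∈ regSet N lam Φ D) :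
    mDir (0, 1) (coeffFun N lam Φ 0) p
      = laxV (uNew u N lam Φ) (vNew v N lam Φ) 0 p * coeffFun N lam Φ 0 p
        - coeffFun N lam Φ 0 p * laxV u v 0 p := by
  have h := coeffFun_relation_T hN hs hΦ hp 0 (by omega)
  rw [shiftCoeff, if_pos rfl, Matrix.zero_mul, Matrix.mul_zero, sub_zero, smul_zero, sub_zero]
    at h
  rw [eq_sub_iff_add_eq]
  exact sub_eq_zero.1 h

lemma laxU_one_differentiableAt (hD : IsOpen D) (hu : ContDiffOn ℝ ∞ u D)
    (hv : ContDiffOn ℝ ∞ v D) (hρ : ContDiffOn ℝ ∞ ρ D) {p : ℝ × ℝ} (hp : p ∈ D) (r s : Fin 2) :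
    DifferentiableAt ℝ (fun y => laxU u v ρ 1 y r s) p := by
  have dρ := differentiableAt_of_smooth hD hρ hp
  have dux := differentiableAt_of_smooth hD (contDiffOn_dFst hD hu) hp
  have dvx := differentiableAt_of_smooth hD (contDiffOn_dFst hD hv) hp
  simp only [laxU_one]
  fin_cases r <;> fin_cases s <;> simp <;> fun_prop

include hN hlam hs hΦ in
/-- The new potentials solve the system: the zero curvature equation and the normalization
`det (z U) = const` are transported by conjugation with `T_N(0)`. -/
lemma isPlaneSystemSolution_new :
    IsPlaneSystemSolution (uNew u N lam Φ) (vNew v N lam Φ) (ρNew ρ N lam Φ)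
      (regSet N lam Φ D) := by
  have hΦs : ∀ j < 2 * N, ∀ s, ContDiffOn ℝ ∞ (fun p => Φ j p s) D := fun j hj => (hΦ j hj).smooth
  have hO := isOpen_regSet (lam := lam) hs.isOpen hΦs
  have su := contDiffOn_uNew (lam := lam) hΦs hs.smooth_u
  have sv := contDiffOn_vNew (lam := lam) hΦs hs.smooth_v
  have sρ := contDiffOn_ρNew (lam := lam) hs.isOpen hΦs hs.smooth_ρ
  have key : ∀ p ∈ regSet N lam Φ D, _ := fun p hp => (zeroCurvature_iff hO su sv sρ hp).1 (by
    have dC := fun r s => coeffFun_differentiableAt hs.isOpen hΦs hp 0 r s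
    have hdet := dtCoeff_zero_det_ne_zero hN hlam hp.2
    have hunit : IsUnit (coeffFun N lam Φ 0 p) :=
      (Matrix.isUnit_iff_isUnit_det _).2 (isUnit_iff_ne_zero.2 hdet)
    have h1 : mDir (0, 1) (fun y => coeffFun N lam Φ 0 y * laxU u v ρ 1 y) p
        = mDir (0, 1) (fun y => laxU (uNew u N lam Φ) (vNew v N lam Φ) (ρNew ρ N lam Φ) 1 y
          * coeffFun N lam Φ 0 y) p := by
      refine mDir_congr ?_
      filter_upwards [hO.mem_nhds hp] with y hy
      exact coeffFun_zero_mul_laxU hN hlam hs hΦ hy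
    rw [mDir_mul dC (laxU_one_differentiableAt hs.isOpen hs.smooth_u hs.smooth_v hs.smooth_ρ hp.1),
      mDir_mul (laxU_one_differentiableAt hO su sv sρ hp) dC,
      seed_zeroCurvature hs hN hlam hΦ hp, mDir_coeffFun_zero hN hs hΦ hp] at h1
    -- With `C₀Q = Q'C₀`, the `T`-derivative of this identity is `Q'_T C₀ = [P', Q'] C₀`.
    have h2 := coeffFun_zero_mul_laxU hN hlam hs hΦ hp
    refine hunit.mul_right_cancel ?_
    rw [← sub_eq_iff_eq_add] at h1
    rw [← h1]
    simp only [Matrix.sub_mul, Matrix.mul_sub, Matrix.mul_assoc]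
    rw [h2]
    simp only [← Matrix.mul_assoc]
    rw [← h2]
    abel)
  refine ⟨hO, su, sv, sρ, fun p hp => (key p hp).1, fun p hp => (key p hp).2.1,
    fun p hp => (key p hp).2.2, fun p hp => ?_⟩
  -- `det Q = (ρ² - u_X v_X) / 4` is invariant under conjugation.
  have h := congrArg Matrix.det (coeffFun_zero_mul_laxU hN hlam hs hΦ hp)
  rw [det_mul, det_mul, mul_comm (Matrix.det (laxU _ _ _ _ _))] at h
  have h2 := mul_left_cancel₀ (dtCoeff_zero_det_ne_zero hN hlam hp.2) h
  rw [laxU_one, laxU_one, det_fin_two_of, det_fin_two_of] at h2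
  rw [← hs.normalized p hp.1]
  linear_combination -4 * h2 + (ρNew ρ N lam Φ p ^ 2 - ρ p ^ 2
    - dFst (uNew u N lam Φ) p * dFst (vNew v N lam Φ) p + dFst u p * dFst v p) * Complex.I_sq

include hN hs hΦ in
/-- The primitive of `ρ dX - uv dT` is transformed by adding `2i a_{N-1}`; for the `T`-derivative
this is a diagonal entry of the relation for `(C_{N-1})_T`. -/
lemma isHodograph_new {x₀ : ℝ × ℝ → ℂ} (hx : IsHodograph u v ρ x₀ D) :
    IsHodograph (uNew u N lam Φ) (vNew v N lam Φ) (ρNew ρ N lam Φ) (xNew x₀ N lam Φ)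
      (regSet N lam Φ D) := by
  have hΦs : ∀ j < 2 * N, ∀ s, ContDiffOn ℝ ∞ (fun p => Φ j p s) D := fun j hj => (hΦ j hj).smooth
  refine ⟨contDiffOn_xNew hΦs hx.smooth, fun p hp => ?_, fun p hp => ?_⟩
  · have dC := coeffFun_differentiableAt hs.isOpen hΦs hp (N - 1) 0 0
    have dx := differentiableAt_of_smooth hs.isOpen hx.smooth hp.1
    rw [xNew_eq, ρNew_eq, dFst_eq_dDir (dx.fun_add ((differentiableAt_const _).fun_mul dC)),
      dDir_add dx ((differentiableAt_const _).fun_mul dC), dDir_const_mul _ dC,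
      ← dFst_eq_dDir dx, ← dFst_eq_dDir dC, hx.eqn_X p hp.1]
  · have dC := coeffFun_differentiableAt hs.isOpen hΦs hp (N - 1) 0 0
    have dx := differentiableAt_of_smooth hs.isOpen hx.smooth hp.1
    have h := congrFun (congrFun (coeffFun_relation_T hN hs hΦ hp (N - 1) (by omega)) 0) 0
    rw [laxV_zero, laxV_zero] at h
    simp [sigma, mul_apply, Fin.sum_univ_two, vecMul, dotProduct, mDir] at h
    rw [xNew_eq, dSnd_eq_dDir (dx.fun_add ((differentiableAt_const _).fun_mul dC)),
      dDir_add dx ((differentiableAt_const _).fun_mul dC), dDir_const_mul _ dC,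
      ← dSnd_eq_dDir dx, hx.eqn_T p hp.1]
    rw [uNew_eq] at h
    rw [uNew_eq, vNew_eq]
    linear_combination 2 * Complex.I * h

/-! ### The iterated potentials -/

/-- The subleading coefficient of `T_k` is the sum of the coefficients of the first `k` factors.
The case `k = 0` is separate, as there `N - 1` in `delta` truncates. For `ρ` the identity is
differentiated, so it is needed in a neighbourhood of `p`. -/
lemma iterated_potentials (hD : IsOpen D)
    (hΦ : ∀ j < 2 * N, ∀ s, ContDiffOn ℝ ∞ (fun p => Φ j p s) D) {k : ℕ} (hk : k ≤ N) :
    ∀ p ∈ D, (∀ i, 1 ≤ i → i ≤ k → wDet i lam Φ p ≠ 0) →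
      iterU u lam Φ k p = (if k = 0 then u p else uNew u k lam Φ p) ∧
      iterV v lam Φ k p = (if k = 0 then v p else vNew v k lam Φ p) ∧
      iterRho ρ lam Φ k p = (if k = 0 then ρ p else ρNew ρ k lam Φ p) := by
  induction k with
  | zero => intro p _ _; exact ⟨rfl, rfl, rfl⟩
  | succ k ih =>
    intro p hp hW
    obtain ⟨h1, h2, h3⟩ := ih (by omega) p hp fun i hi hi' => hW i hi (by omega)
    have hcoef : ∀ y, (∀ i, 1 ≤ i → i ≤ k + 1 → wDet i lam Φ y ≠ 0) → ∀ r s,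
        stepCoeff lam (vals Φ y) k r s = coeffFun (k + 1) lam Φ k y r s
          - (if k = 0 then 0 else coeffFun k lam Φ (k - 1) y) r s := by
      intro y hy r s
      rw [coeffFun, dtCoeff_succ_eq hy, Matrix.add_apply]
      simp only [coeffFun]
      ring
    simp only [iterU, iterV, iterRho, h1, h2, h3, uNew_eq, vNew_eq, ρNew_eq, hcoef p hW,
      Nat.add_sub_cancel, Nat.succ_ne_zero, if_false]
    refine ⟨?_, ?_, ?_⟩
    · by_cases hk0 : k = 0
      · simp [hk0]
      · simp only [hk0, if_false]; ring
    · by_cases hk0 : k = 0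
      · simp [hk0]
      · simp only [hk0, if_false]; ring
    · have hev : ∀ᶠ y in 𝓝 p, ∀ i, 1 ≤ i → i ≤ k + 1 → wDet i lam Φ y ≠ 0 := by
        have : ∀ᶠ y in 𝓝 p, ∀ i ∈ Finset.Icc 1 (k + 1), wDet i lam Φ y ≠ 0 := by
          rw [Filter.eventually_all_finset]
          intro i hi
          rw [Finset.mem_Icc] at hi
          have hc : ContDiffOn ℝ ∞ (wDet i lam Φ) D :=
            contDiffOn_wDet fun j hj => hΦ j (by omega)
          exact (hc.continuousOn.continuousAt (hD.mem_nhds hp)).eventually_ne (hW i hi.1 hi.2)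
        exact this.mono fun y hy i h1 h2 => hy i (Finset.mem_Icc.2 ⟨h1, h2⟩)
      have hd : ∀ m, 1 ≤ m → m ≤ k + 1 → DifferentiableAt ℝ
          (fun y => coeffFun m lam Φ (m - 1) y 0 0) p := fun m hm1 hm2 =>
        coeffFun_differentiableAt hD (fun j hj => hΦ j (by omega)) ⟨hp, hW m hm1 hm2⟩ _ _ _
      rw [dFst_congr (hev.mono fun y hy => hcoef y hy 0 0)]
      have hd1 := hd (k + 1) (by omega) le_rfl
      rw [Nat.add_sub_cancel] at hd1
      by_cases hk0 : k = 0
      · simp [hk0]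
      · have hd2 := hd k (by omega) (by omega)
        simp only [hk0, if_false]
        rw [dFst_eq_dDir (hd1.fun_sub hd2), dDir_sub hd1 hd2, dFst_eq_dDir hd1, dFst_eq_dDir hd2]
        ring

end Darboux

/-! ### The hodograph transformation -/

section Hodograph

variable {D O : Set (ℝ × ℝ)} {u v ρ x : ℝ × ℝ → ℂ}

lemma IsPlaneSystemSolution.swap (h : IsPlaneSystemSolution u v ρ D) :
    IsPlaneSystemSolution v u ρ D where
  isOpen := h.isOpen
  smooth_u := h.smooth_v
  smooth_v := h.smooth_u
  smooth_ρ := h.smooth_ρ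
  eqn_u := h.eqn_v
  eqn_v := h.eqn_u
  eqn_ρ := fun p hp => by simpa only [mul_comm] using h.eqn_ρ p hp
  normalized := fun p hp => by simpa only [mul_comm] using h.normalized p hp

lemma IsHodograph.swap (h : IsHodograph u v ρ x D) : IsHodograph v u ρ x D where
  smooth := h.smooth
  eqn_X := h.eqn_X
  eqn_T := fun p hp => by rw [h.eqn_T p hp, mul_comm]

/-- The short pulse equation in the parameters `(X,T)`; only `u_XT = -2uρ` and `ρ_T = -(uv)_X`
enter. -/
lemma parametric_eqn (h : IsPlaneSystemSolution u v ρ D) (hx : IsHodograph u v ρ x D) {p : ℝ × ℝ}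
    (hp : p ∈ D) (h0 : ρ p ≠ 0) :
    hodDt x (hodDx x u) p - 2 * u p + hodDx x (fun s => u s * v s * hodDx x u s) p = 0 := by
  have hD := h.isOpen
  have hn := hD.mem_nhds hp
  have du := differentiableAt_of_smooth hD h.smooth_u hp
  have dv := differentiableAt_of_smooth hD h.smooth_v hp
  have dρ := differentiableAt_of_smooth hD h.smooth_ρ hp
  have dux := differentiableAt_of_smooth hD (contDiffOn_dFst hD h.smooth_u) hp
  have hG : hodDx x u =ᶠ[𝓝 p] fun s => dFst u s / ρ s := by
    filter_upwards [hn] with s hs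
    rw [hodDx, hx.eqn_X s hs]
  have dG : DifferentiableAt ℝ (fun s => dFst u s / ρ s) p := by
    simp only [div_eq_mul_inv]
    exact dux.fun_mul (dρ.fun_inv h0)
  have huvG : (fun s => u s * v s * hodDx x u s) =ᶠ[𝓝 p]
      fun s => u s * v s * (dFst u s / ρ s) := by
    filter_upwards [hG] with s hs
    rw [hs]
  have hρT := h.eqn_ρ p hp
  have huXT := h.eqn_u p hp
  rw [dSnd_eq_dDir dρ, dFst_eq_dDir (du.fun_mul dv)] at hρT
  rw [dSnd_eq_dDir dux] at huXT
  rw [hodDt, hodDx, hodDx, hx.eqn_X p hp, hx.eqn_T p hp, dSnd_congr hG, dFst_congr hG,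
    dFst_congr huvG, dSnd_eq_dDir dG, dFst_eq_dDir dG, dFst_eq_dDir ((du.fun_mul dv).fun_mul dG),
    dDir_mul (du.fun_mul dv) dG, dDir_div (e := (0, 1)) dux dρ h0, hρT, huXT]
  field_simp
  ring

lemma contDiffOn_hodDx (hO : IsOpen O) (hx : ContDiffOn ℝ ∞ x O) (hreg : ∀ p ∈ O, dFst x p ≠ 0)
    {g : ℝ × ℝ → ℂ} (hg : ContDiffOn ℝ ∞ g O) : ContDiffOn ℝ ∞ (hodDx x g) O := by
  have : hodDx x g = fun p => dFst g p * (dFst x p)⁻¹ := by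
    funext p; rw [hodDx, div_eq_mul_inv]
  rw [this]
  exact (contDiffOn_dFst hO hg).mul ((contDiffOn_dFst hO hx).inv hreg)

lemma contDiffOn_hodMap (hx : ContDiffOn ℝ ∞ x O) : ContDiffOn ℝ ∞ (hodMap x) O :=
  (Complex.reCLM.contDiff.comp_contDiffOn hx).prodMk contDiff_snd.neg.contDiffOn

lemma IsRegion.dDir_im (hR : IsRegion x D O) (hx : ContDiffOn ℝ ∞ x O) {p : ℝ × ℝ} (hp : p ∈ O)
    (e : ℝ × ℝ) : (dDir e x p).im = 0 := by
  have dx := differentiableAt_of_smooth hR.isOpen hx hp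
  have h1 : HasFDerivAt (fun y => (x y).im) (Complex.imCLM.comp (fderiv ℝ x p)) p :=
    Complex.imCLM.hasFDerivAt.comp p dx.hasFDerivAt
  have h2 : HasFDerivAt (fun y => (x y).im) (0 : ℝ × ℝ →L[ℝ] ℝ) p := by
    refine (hasFDerivAt_const (0 : ℝ) p).congr_of_eventuallyEq ?_
    filter_upwards [hR.isOpen.mem_nhds hp] with y hy
    exact hR.real y hy
  exact congrArg (fun L : ℝ × ℝ →L[ℝ] ℝ => L e) (h1.unique h2)

/-- The derivative of the hodograph map at a point of a region; it is invertible. -/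
lemma IsRegion.exists_equiv (hR : IsRegion x D O) (hx : ContDiffOn ℝ ∞ x O) {p : ℝ × ℝ}
    (hp : p ∈ O) : ∃ L : (ℝ × ℝ) ≃L[ℝ] (ℝ × ℝ),
      HasFDerivAt (hodMap x) (L : ℝ × ℝ →L[ℝ] ℝ × ℝ) p ∧ ∀ e, L e = ((dDir e x p).re, -e.2) := by
  have dx := differentiableAt_of_smooth hR.isOpen hx hp
  let A : ℝ × ℝ →L[ℝ] ℝ × ℝ :=
    (Complex.reCLM.comp (fderiv ℝ x p)).prod (-ContinuousLinearMap.snd ℝ ℝ ℝ)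
  have hA : HasFDerivAt (hodMap x) A p :=
    (Complex.reCLM.hasFDerivAt.comp p dx.hasFDerivAt).prodMk hasFDerivAt_snd.neg
  have hAe : ∀ e, A e = ((dDir e x p).re, -e.2) := fun e => rfl
  have hinj : Function.Injective (A : ℝ × ℝ →ₗ[ℝ] ℝ × ℝ) := by
    rw [← LinearMap.ker_eq_bot, LinearMap.ker_eq_bot']
    intro e he
    have he' : ((dDir e x p).re, -e.2) = (0 : ℝ × ℝ) := (hAe e).symm.trans he
    have h2 : e.2 = 0 := by simpa using congrArg Prod.snd he'
    have h1 : (dDir e x p).re = 0 := congrArg Prod.fst he'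
    have he1 : e = e.1 • ((1 : ℝ), (0 : ℝ)) := by
      ext
      · simp
      · simpa using h2
    have h3 : dDir e x p = e.1 * dDir (1, 0) x p := by
      conv_lhs => rw [he1]
      simp only [dDir, map_smul, Complex.real_smul]
    have h4 : dDir e x p = 0 := Complex.ext h1 (hR.dDir_im hx hp e)
    have h5 := hR.regular p hp
    rw [dFst_eq_dDir dx] at h5
    rw [h3, mul_eq_zero, or_iff_left h5, Complex.ofReal_eq_zero] at h4
    exact Prod.ext h4 h2
  refine ⟨(LinearEquiv.ofInjectiveEndo (A : ℝ × ℝ →ₗ[ℝ] ℝ × ℝ)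
    hinj).toContinuousLinearEquiv, ?_, hAe⟩
  convert! hA

lemma IsRegion.image_mem_nhds (hR : IsRegion x D O) (hx : ContDiffOn ℝ ∞ x O) {p : ℝ × ℝ}
    (hp : p ∈ O) {S : Set (ℝ × ℝ)} (hS : S ∈ 𝓝 p) : hodMap x '' S ∈ 𝓝 (hodMap x p) := by
  obtain ⟨L, hL, -⟩ := hR.exists_equiv hx hp
  have hst := ((contDiffOn_hodMap hx).contDiffAt (hR.isOpen.mem_nhds hp)).hasStrictFDerivAt' hL
    (by simp)
  rw [← hst.map_nhds_eq_of_equiv]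
  exact image_mem_map hS

lemma IsRegion.isOpen_image (hR : IsRegion x D O) (hx : ContDiffOn ℝ ∞ x O) :
    IsOpen (hodMap x '' O) := by
  rw [isOpen_iff_mem_nhds]
  rintro _ ⟨p, hp, rfl⟩
  exact hR.image_mem_nhds hx hp (hR.isOpen.mem_nhds hp)

lemma IsRegion.exists_injOn (hR : IsRegion x D O) (hx : ContDiffOn ℝ ∞ x O) {p : ℝ × ℝ}
    (hp : p ∈ O) : ∃ O' ⊆ O, p ∈ O' ∧ IsOpen O' ∧ Set.InjOn (hodMap x) O' := by
  obtain ⟨L, hL, -⟩ := hR.exists_equiv hx hp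
  have hst := ((contDiffOn_hodMap hx).contDiffAt (hR.isOpen.mem_nhds hp)).hasStrictFDerivAt' hL
    (by simp)
  let φ := hst.toOpenPartialHomeomorph (hodMap x)
  exact ⟨φ.source ∩ O, Set.inter_subset_right, ⟨hst.mem_toOpenPartialHomeomorph_source, hp⟩,
    φ.open_source.inter hR.isOpen, φ.injOn.mono Set.inter_subset_left⟩

/-- Near `h(p)` the function `f` is `g` composed with the smooth local inverse of `h`. -/
lemma IsRegion.contDiffOn_of_comp (hR : IsRegion x D O) (hx : ContDiffOn ℝ ∞ x O)
    {f g : ℝ × ℝ → ℂ} (hg : ContDiffOn ℝ ∞ g O) (hfg : ∀ p ∈ O, f (hodMap x p) = g p) :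
    ContDiffOn ℝ ∞ f (hodMap x '' O) := by
  rintro _ ⟨p, hp, rfl⟩
  obtain ⟨L, hL, -⟩ := hR.exists_equiv hx hp
  have hn := hR.isOpen.mem_nhds hp
  have hcd := (contDiffOn_hodMap hx).contDiffAt hn
  have hst := hcd.hasStrictFDerivAt' hL (by simp)
  have hψ := hcd.to_localInverse hL (by simp)
  set ψ := hcd.localInverse hL (by simp) with hψdef
  have hψp : ψ (hodMap x p) = p := hcd.localInverse_apply_image hL (by simp)
  have hgψ : ContDiffAt ℝ ∞ (fun w => g (ψ w)) (hodMap x p) :=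
    ContDiffAt.comp (hodMap x p) (by rw [hψp]; exact hg.contDiffAt hn) hψ
  refine (hgψ.congr_of_eventuallyEq ?_).contDiffWithinAt
  have h1 : ∀ᶠ w in 𝓝 (hodMap x p), ψ w ∈ O :=
    hψ.continuousAt.eventually (by rw [hψp]; exact hn)
  filter_upwards [h1, hst.eventually_right_inverse] with w hw hw2
  rw [← hfg _ hw]
  exact congrArg f hw2.symm

/-- The operators `hodDx x` and `hodDt x` are `∂/∂x` and `∂/∂t` for the change of variables. -/
lemma IsRegion.chain_rule (hR : IsRegion x D O) (hx : ContDiffOn ℝ ∞ x O)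
    {f g : ℝ × ℝ → ℂ} (hg : ContDiffOn ℝ ∞ g O) (hfg : ∀ p ∈ O, f (hodMap x p) = g p)
    {p : ℝ × ℝ} (hp : p ∈ O) :
    dFst f (hodMap x p) = hodDx x g p ∧ dSnd f (hodMap x p) = hodDt x g p := by
  obtain ⟨L, hL, hLe⟩ := hR.exists_equiv hx hp
  have dx := differentiableAt_of_smooth hR.isOpen hx hp
  have dg := differentiableAt_of_smooth hR.isOpen hg hp
  have df := differentiableAt_of_smooth (hR.isOpen_image hx) (hR.contDiffOn_of_comp hx hg hfg)
    (Set.mem_image_of_mem _ hp)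
  have hcomp : ∀ e, dDir e g p
      = dDir e x p * dFst f (hodMap x p) - e.2 * dSnd f (hodMap x p) := by
    intro e
    have h1 : dDir e g p = fderiv ℝ f (hodMap x p) (L e) := by
      have h2 := (df.hasFDerivAt.comp p hL).fderiv
      have h3 : dDir e g p = dDir e (f ∘ hodMap x) p := dDir_congr (by
        filter_upwards [hR.isOpen.mem_nhds hp] with y hy
        exact (hfg y hy).symm)
      rw [h3, dDir, h2]; rfl
    have h4 : L e = (dDir e x p).re • ((1 : ℝ), (0 : ℝ)) + (-e.2) • ((0 : ℝ), (1 : ℝ)) := by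
      rw [hLe]; ext <;> simp
    have h5 : ((dDir e x p).re : ℂ) = dDir e x p :=
      Complex.ext rfl (by simp [hR.dDir_im hx hp e])
    rw [h1, h4, map_add, map_smul, map_smul, dFst_eq_dDir df, dSnd_eq_dDir df, Complex.real_smul,
      Complex.real_smul, h5]
    simp only [dDir]; push_cast; ring
  have h0 := hR.regular p hp
  have hX := hcomp (1, 0)
  have hT := hcomp (0, 1)
  rw [← dFst_eq_dDir dx, ← dFst_eq_dDir dg] at hX
  rw [← dSnd_eq_dDir dx, ← dSnd_eq_dDir dg] at hT
  have hx1 : dFst f (hodMap x p) = hodDx x g p := by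
    rw [hodDx, hX]; field_simp; simp
  refine ⟨hx1, ?_⟩
  rw [hodDt, ← hx1, hT]; push_cast; ring

/-- One equation of the two-component short pulse system, from its parametric form. -/
lemma IsRegion.sp_eqn (hR : IsRegion x D O) (h : IsPlaneSystemSolution u v ρ D)
    (hx : IsHodograph u v ρ x D) {q r : ℝ × ℝ → ℂ} (hq : ∀ p ∈ O, q (hodMap x p) = u p)
    (hr : ∀ p ∈ O, r (hodMap x p) = v p) {p : ℝ × ℝ} (hp : p ∈ O) :
    dSnd (dFst q) (hodMap x p) - 2 * q (hodMap x p)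
      + dFst (fun w => q w * r w * dFst q w) (hodMap x p) = 0 := by
  have sx := hx.smooth.mono hR.subset
  have su := h.smooth_u.mono hR.subset
  have sv := h.smooth_v.mono hR.subset
  have hqx : ∀ p ∈ O, dFst q (hodMap x p) = hodDx x u p := fun p hp =>
    (hR.chain_rule sx su hq hp).1
  have sG := contDiffOn_hodDx hR.isOpen sx hR.regular su
  rw [(hR.chain_rule sx sG hqx hp).2, hq p hp,
    (hR.chain_rule sx (g := fun s => u s * v s * hodDx x u s) ((su.mul sv).mul sG)
      (fun s hs => by rw [hq s hs, hr s hs, hqx s hs]) hp).1]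
  refine parametric_eqn h hx (hR.subset hp) ?_
  rw [← hx.eqn_X p (hR.subset hp)]
  exact hR.regular p hp

lemma IsRegion.isSPSystemSolution (hR : IsRegion x D O) (h : IsPlaneSystemSolution u v ρ D)
    (hx : IsHodograph u v ρ x D) {q r : ℝ × ℝ → ℂ} (hq : ∀ p ∈ O, q (hodMap x p) = u p)
    (hr : ∀ p ∈ O, r (hodMap x p) = v p) : IsSPSystemSolution q r (hodMap x '' O) where
  isOpen := hR.isOpen_image (hx.smooth.mono hR.subset)
  smooth_q := hR.contDiffOn_of_comp (hx.smooth.mono hR.subset) (h.smooth_u.mono hR.subset) hq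
  smooth_r := hR.contDiffOn_of_comp (hx.smooth.mono hR.subset) (h.smooth_v.mono hR.subset) hr
  eqn_q := by
    rintro _ ⟨p, hp, rfl⟩
    exact hR.sp_eqn h hx hq hr hp
  eqn_r := by
    rintro _ ⟨p, hp, rfl⟩
    exact hR.sp_eqn h.swap hx.swap hr hq hp

/-! ### The nonlocal equation -/

lemma hodMap_neg (hodd : ∀ p ∈ D, x (-p) = -x p) {p : ℝ × ℝ} (hp : p ∈ D) :
    hodMap x (-p) = -hodMap x p := by
  simp [hodMap, hodd p hp]

lemma isParametricSolution_of_odd (h : IsPlaneSystemSolution u v ρ D) (hD : IsReflSymm D)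
    (hx : IsHodograph u v ρ x D) (hodd : ∀ p ∈ D, x (-p) = -x p)
    (hv : ∀ p ∈ D, v p = -u (-p)) : IsParametricSolution u x D where
  isOpen := h.isOpen
  symm := hD
  smooth_q := h.smooth_u
  smooth_x := hx.smooth
  odd := hodd
  eqn := fun p hp h0 => by
    have h1 := parametric_eqn h hx hp (by rw [← hx.eqn_X p hp]; exact h0)
    have h2 : hodDx x (fun s => -(u s * u (-s) * hodDx x u s)) p
        = hodDx x (fun s => u s * v s * hodDx x u s) p := by
      rw [hodDx, hodDx, dFst_congr]
      filter_upwards [h.isOpen.mem_nhds hp] with s hs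
      rw [hv s hs]; ring
    rw [h2]; exact h1

lemma IsRegion.isNonlocalSPSolution (hR : IsRegion x D O) (h : IsPlaneSystemSolution u v ρ D)
    (hx : IsHodograph u v ρ x D) (hodd : ∀ p ∈ D, x (-p) = -x p) (hv : ∀ p ∈ D, v p = -u (-p))
    (hO : IsReflSymm O) {q : ℝ × ℝ → ℂ} (hq : ∀ p ∈ O, q (hodMap x p) = u p) :
    IsNonlocalSPSolution q (hodMap x '' O) := by
  -- As `h` is odd, `w ↦ -q(-w)` is the second component of the system.
  have hsys := hR.isSPSystemSolution h hx (r := fun w => -q (-w)) hq fun p hp => by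
    rw [← hodMap_neg hodd (hR.subset hp), hq _ (hO p hp), hv p (hR.subset hp)]
  refine ⟨hsys.isOpen, ?_, hsys.smooth_q, fun z hz => ?_⟩
  · rintro _ ⟨p, hp, rfl⟩
    exact ⟨-p, hO p hp, hodMap_neg hodd (hR.subset hp)⟩
  · have h1 := hsys.eqn_q z hz
    have h2 : (fun w => q w * -q (-w) * dFst q w) = fun w => -(q w * q (-w) * dFst q w) := by
      funext w; ring
    rw [h2] at h1
    exact h1

/-- Near a point `p₀` with `h(p₀) ≠ 0` the map is injective on the union of a small neighbourhood
and its reflection, since the images lie near the distinct points `h(p₀)` and `-h(p₀)`. -/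
lemma IsRegion.exists_injOn_symm (hR : IsRegion x D O) (hx : ContDiffOn ℝ ∞ x O)
    (hodd : ∀ p ∈ D, x (-p) = -x p) (hO : IsReflSymm O) {p₀ : ℝ × ℝ} (hp₀ : p₀ ∈ O)
    (h0 : p₀ = 0 ∨ hodMap x p₀ ≠ 0) :
    ∃ O' ⊆ O, p₀ ∈ O' ∧ IsOpen O' ∧ IsReflSymm O' ∧ Set.InjOn (hodMap x) O' := by
  obtain ⟨B, hBO, hpB, hB, hinj⟩ := hR.exists_injOn hx hp₀
  have hneg : ∀ p ∈ O, hodMap x (-p) = -hodMap x p := fun p hp =>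
    hodMap_neg hodd (hR.subset hp)
  rcases h0 with rfl | h0
  · refine ⟨B ∩ -B, fun p hp => hBO hp.1, ⟨hpB, by simpa using hpB⟩, hB.inter hB.neg,
      fun p hp => ⟨hp.2, by simpa using hp.1⟩, hinj.mono Set.inter_subset_left⟩
  · have hne : hodMap x p₀ ≠ -hodMap x p₀ := fun h => h0 (self_eq_neg.1 h)
    obtain ⟨V, W, hV, hW, hpV, hpW, hVW⟩ := t2_separation hne
    have hcont : ContinuousOn (hodMap x) B := (contDiffOn_hodMap hx).continuousOn.mono hBO
    let A := B ∩ hodMap x ⁻¹' (V ∩ -W)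
    have hA : IsOpen A := hcont.isOpen_inter_preimage hB (hV.inter hW.neg)
    have hAO : A ⊆ O := fun p hp => hBO hp.1
    have hAV : ∀ p ∈ A, hodMap x p ∈ V := fun p hp => hp.2.1
    have hAW : ∀ p ∈ A, -hodMap x p ∈ W := fun p hp => hp.2.2
    have hAinj : Set.InjOn (hodMap x) A := hinj.mono Set.inter_subset_left
    have hcross : ∀ a ∈ A, ∀ b, -b ∈ A → hodMap x a ≠ hodMap x b := by
      intro a ha b hb hab
      have : hodMap x b ∈ W := by
        have h1 := hAW _ hb
        have h2 := hneg _ (hAO hb)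
        rw [neg_neg] at h2
        rwa [h2]
      exact Set.disjoint_left.1 hVW (hAV a ha) (hab ▸ this)
    refine ⟨A ∪ -A, ?_, Or.inl ⟨hpB, hpV, hpW⟩, hA.union hA.neg, ?_, ?_⟩
    · rintro p (hp | hp)
      · exact hAO hp
      · simpa using hO _ (hAO hp)
    · rintro p (hp | hp)
      · exact Or.inr (by simpa using hp)
      · exact Or.inl hp
    · rintro a (ha | ha) b (hb | hb) hab
      · exact hAinj ha hb hab
      · exact absurd hab (hcross a ha b hb)
      · exact absurd hab.symm (hcross b hb a ha)
      · refine neg_injective (hAinj ha hb ?_)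
        rw [← neg_neg a, hneg _ (hAO ha), ← neg_neg b, hneg _ (hAO hb)] at hab
        exact neg_injective hab

end Hodograph

/-! ### The nonlocal reduction -/

/-- The matrix exchanging the two components of an eigenfunction. -/
def swapMat : Matrix (Fin 2) (Fin 2) ℂ := !![0, 1; 1, 0]

lemma swapMat_mul_self : swapMat * swapMat = 1 := by
  ext r s
  fin_cases r <;> fin_cases s <;> simp [swapMat]

section Swap

variable {N : ℕ} {lam : ℕ → ℂ} {F G : ℕ → Fin 2 → ℂ}

lemma wMat_det_ne_zero_of_swap (h : ∀ j < 2 * N, ∃ ε : ℂ, ε ≠ 0 ∧ G j = ε • swapMat.mulVec (F j))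
    (hW : (wMat N lam F).det ≠ 0) : (wMat N lam G).det ≠ 0 := by
  refine wMat_det_ne_zero_of_rows fun E hE i hi => ?_
  have h1 := row_eq_zero hW (fun i => E i ᵥ* swapMat) (fun j hj => ?_) i hi
  · have h2 := congrArg (fun w => w ᵥ* swapMat) h1
    simpa [vecMul_vecMul, swapMat_mul_self] using h2
  · obtain ⟨ε, hε, hG⟩ := h j hj
    have h3 := hE j hj
    simp only [hG, dotProduct_smul, dotProduct_mulVec, smul_eq_mul, mul_left_comm _ ε] at h3
    rw [← mul_sum] at h3
    exact (mul_eq_zero.1 h3).resolve_left hε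

lemma dtCoeff_of_swap (h : ∀ j < 2 * N, ∃ ε : ℂ, ε ≠ 0 ∧ G j = ε • swapMat.mulVec (F j))
    (hW : (wMat N lam F).det ≠ 0) {i : ℕ} (hi : i < N) :
    dtCoeff N lam G i = swapMat * dtCoeff N lam F i * swapMat := by
  refine (eq_dtCoeff (wMat_det_ne_zero_of_swap h hW)
    (fun i => swapMat * dtCoeff N lam F i * swapMat) (fun j hj => ?_) i hi).symm
  have hp : monicPoly N (fun i => swapMat * dtCoeff N lam F i * swapMat) (lam j)
      = swapMat * dtMat N lam F (lam j) * swapMat := by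
    simp only [monicPoly, dtMat, Matrix.mul_add, Matrix.add_mul, Matrix.mul_smul, Matrix.smul_mul,
      Matrix.mul_one, swapMat_mul_self, Matrix.mul_sum, Matrix.sum_mul]
  obtain ⟨ε, hε, hG⟩ := h j hj
  rw [hp, hG, mulVec_smul, mulVec_mulVec, Matrix.mul_assoc, swapMat_mul_self, Matrix.mul_one,
    ← mulVec_mulVec, dtMat_mulVec_eq_zero hW hj, mulVec_zero, smul_zero]

end Swap

section Nonlocal

variable {D : Set (ℝ × ℝ)} {u v ρ : ℝ × ℝ → ℂ} {N : ℕ} {lam : ℕ → ℂ}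
  {Φ : ℕ → ℝ × ℝ → Fin 2 → ℂ}

/-- Under the reduction the data at `-p` are those at `p` with exchanged components, with the sign
`1` for the first and `-1` for the second eigenfunction of each pair. -/
lemma vals_neg (hD : IsReflSymm D) (hR : HasReduction N Φ D) {p : ℝ × ℝ} (hp : p ∈ D) :
    ∀ j < 2 * N, ∃ ε : ℂ, ε ≠ 0 ∧ vals Φ (-p) j = ε • swapMat.mulVec (vals Φ p j) := by
  intro j hj
  have h1 := hR (j / 2) (by omega) p hp
  have h2 := hR (j / 2) (by omega) (-p) (hD p hp)
  rw [neg_neg] at h2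
  rcases Nat.even_or_odd' j with ⟨k, rfl | rfl⟩
  · rw [Nat.mul_div_cancel_left k (by norm_num)] at h1 h2
    refine ⟨1, one_ne_zero, ?_⟩
    funext s
    fin_cases s
    · simp [vals, swapMat, dotProduct, h2.1]
    · simp [vals, swapMat, dotProduct, h1.1]
  · rw [show (2 * k + 1) / 2 = k by omega] at h1 h2
    refine ⟨-1, by simp, ?_⟩
    funext s
    fin_cases s
    · simp [vals, swapMat, dotProduct, h2.2]
    · simp [vals, swapMat, dotProduct, h1.2]

lemma isReflSymm_regSet (hD : IsReflSymm D) (hR : HasReduction N Φ D) :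
    IsReflSymm (regSet N lam Φ D) := fun p hp =>
  ⟨hD p hp.1, wMat_det_ne_zero_of_swap (vals_neg hD hR hp.1) hp.2⟩

lemma coeffFun_neg (hN : 1 ≤ N) (hD : IsReflSymm D) (hR : HasReduction N Φ D) {p : ℝ × ℝ}
    (hp : p ∈ regSet N lam Φ D) :
    coeffFun N lam Φ (N - 1) (-p) 0 0 = coeffFun N lam Φ (N - 1) p 1 1 ∧
      coeffFun N lam Φ (N - 1) (-p) 0 1 = coeffFun N lam Φ (N - 1) p 1 0 := by
  have h := dtCoeff_of_swap (lam := lam) (vals_neg hD hR hp.1) hp.2 (i := N - 1) (by omega)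
  simp only [coeffFun, h]
  constructor <;> simp [swapMat, mul_apply, Fin.sum_univ_two, vecMul, dotProduct]

lemma vNew_eq_neg (hN : 1 ≤ N) (hs : IsPlaneNonlocalSolution u v ρ D) (hR : HasReduction N Φ D)
    {p : ℝ × ℝ} (hp : p ∈ regSet N lam Φ D) :
    vNew v N lam Φ p = -uNew u N lam Φ (-p) := by
  simp only [uNew_eq, vNew_eq]
  rw [(coeffFun_neg hN hs.symm hR hp).2, hs.nonlocal p hp.1]
  ring

lemma IsPlaneSystemSolution.toNonlocal (h : IsPlaneSystemSolution u v ρ D) (hD : IsReflSymm D)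
    (hv : ∀ p ∈ D, v p = -u (-p)) : IsPlaneNonlocalSolution u v ρ D where
  isOpen := h.isOpen
  symm := hD
  smooth_u := h.smooth_u
  smooth_v := h.smooth_v
  smooth_ρ := h.smooth_ρ
  eqn_u := h.eqn_u
  eqn_ρ := h.eqn_ρ
  nonlocal := hv
  normalized := h.normalized

/-- `x^[N]` is odd: `a(-p) = d(p)` by the reduction, and `a + d = -∑ λ_j`. -/
lemma xNew_odd (hN : 1 ≤ N) (hD : IsReflSymm D) (hR : HasReduction N Φ D) {x₀ : ℝ × ℝ → ℂ}
    (hx : ∀ p ∈ D, x₀ p + x₀ (-p) = 2 * Complex.I * (∑ j ∈ range (2 * N), lam j)) {p : ℝ × ℝ}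
    (hp : p ∈ regSet N lam Φ D) : xNew x₀ N lam Φ (-p) = -xNew x₀ N lam Φ p := by
  have htr : coeffFun N lam Φ (N - 1) p 0 0 + coeffFun N lam Φ (N - 1) p 1 1
      = -∑ j ∈ range (2 * N), lam j := dtCoeff_trace hN hp.2
  simp only [xNew_eq]
  rw [(coeffFun_neg hN hD hR hp).1]
  linear_combination hx p hp.1 + 2 * Complex.I * htr

end Nonlocal

/-! ### The zero seed -/

section ZeroSeed

lemma dFst_const (c : ℂ) (p : ℝ × ℝ) : dFst (fun _ => c) p = 0 := by simp [dFst]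

lemma dSnd_const (c : ℂ) (p : ℝ × ℝ) : dSnd (fun _ => c) p = 0 := by simp [dSnd]

lemma zeroSeed_isSolution : IsPlaneNonlocalSolution 0 0 1 Set.univ where
  isOpen := isOpen_univ
  symm := fun _ _ => Set.mem_univ _
  smooth_u := contDiffOn_const
  smooth_v := contDiffOn_const
  smooth_ρ := contDiffOn_const
  eqn_u := fun p _ => by
    have h : dFst 0 = fun _ => (0 : ℂ) := funext fun y => dFst_const 0 y
    rw [h, dSnd_const]; simp
  eqn_ρ := fun p _ => by
    have h : dSnd 1 p = 0 := dSnd_const 1 p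
    simp [h, dFst_const]
  nonlocal := fun p _ => by simp
  normalized := fun p _ => by
    have h : dFst 0 p = 0 := dFst_const 0 p
    simp [h]

lemma zeroSeed_isHodograph (C : ℂ) :
    IsHodograph 0 0 1 (fun p => (p.1 : ℂ) + C) Set.univ where
  smooth := ((Complex.ofRealCLM.contDiff.comp contDiff_fst).add contDiff_const).contDiffOn
  eqn_X := fun p _ => by
    have h : HasDerivAt (fun s : ℝ => (s : ℂ) + C) 1 p.1 :=
      (HasDerivAt.ofReal_comp (hasDerivAt_id p.1)).add_const C
    exact h.deriv
  eqn_T := fun p _ => by simp [dSnd]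

/-- The exponential `e^{cX + dT}`. -/
noncomputable def planeExp (c d : ℂ) (p : ℝ × ℝ) : ℂ := Complex.exp (c * p.1 + d * p.2)

lemma contDiff_planeExp (c d : ℂ) : ContDiff ℝ ∞ (planeExp c d) :=
  Complex.contDiff_exp.comp
    ((contDiff_const.mul (Complex.ofRealCLM.contDiff.comp contDiff_fst)).add
      (contDiff_const.mul (Complex.ofRealCLM.contDiff.comp contDiff_snd)))

lemma dFst_planeExp (a c d : ℂ) (p : ℝ × ℝ) :
    dFst (fun s => a * planeExp c d s) p = c * (a * planeExp c d p) := by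
  have h : HasDerivAt (fun s : ℝ => c * (s : ℂ) + d * p.2) c p.1 := by
    simpa using ((HasDerivAt.ofReal_comp (hasDerivAt_id p.1)).const_mul c).add_const (d * p.2)
  have h2 := (h.cexp.const_mul a).deriv
  simp only [dFst, planeExp]
  rw [h2]; ring

lemma dSnd_planeExp (a c d : ℂ) (p : ℝ × ℝ) :
    dSnd (fun s => a * planeExp c d s) p = d * (a * planeExp c d p) := by
  have h : HasDerivAt (fun s : ℝ => c * p.1 + d * (s : ℂ)) d p.2 := by
    simpa using ((HasDerivAt.ofReal_comp (hasDerivAt_id p.2)).const_mul d).const_add (c * p.1)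
  have h2 := (h.cexp.const_mul a).deriv
  simp only [dSnd, planeExp]
  rw [h2]; ring

lemma planeExp_mul_neg (c d : ℂ) (p : ℝ × ℝ) : planeExp c d p * planeExp (-c) (-d) p = 1 := by
  rw [planeExp, planeExp, ← Complex.exp_add, ← Complex.exp_zero]
  congr 1
  ring

/-- The equations `f_X = c f`, `f_T = d f` on the plane have only the multiples of
`e^{cX + dT}` as solutions: `f e^{-cX - dT}` is constant. -/
lemma eq_planeExp {f : ℝ × ℝ → ℂ} (hf : ContDiff ℝ ∞ f) {c d : ℂ} (hX : ∀ p, dFst f p = c * f p)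
    (hT : ∀ p, dSnd f p = d * f p) : ∃ a : ℂ, ∀ p, f p = a * planeExp c d p := by
  have df : Differentiable ℝ f := hf.differentiable (by simp)
  have dE : Differentiable ℝ (planeExp (-c) (-d)) :=
    (contDiff_planeExp _ _).differentiable (by simp)
  have dg : Differentiable ℝ (fun y => f y * planeExp (-c) (-d) y) := df.mul dE
  have h1 : ∀ p, dDir (1, 0) (fun y => f y * planeExp (-c) (-d) y) p = 0 := fun p => by
    have := dFst_planeExp 1 (-c) (-d) p
    simp only [one_mul] at this
    rw [dDir_mul (df p) (dE p), ← dFst_eq_dDir (df p), ← dFst_eq_dDir (dE p), hX]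
    change _ + f p * dFst (fun s => planeExp (-c) (-d) s) p = 0
    rw [this]; ring
  have h2 : ∀ p, dDir (0, 1) (fun y => f y * planeExp (-c) (-d) y) p = 0 := fun p => by
    have := dSnd_planeExp 1 (-c) (-d) p
    simp only [one_mul] at this
    rw [dDir_mul (df p) (dE p), ← dSnd_eq_dDir (df p), ← dSnd_eq_dDir (dE p), hT]
    change _ + f p * dSnd (fun s => planeExp (-c) (-d) s) p = 0
    rw [this]; ring
  have h3 : ∀ p, fderiv ℝ (fun y => f y * planeExp (-c) (-d) y) p = 0 := fun p => by
    ext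
    · simpa [dDir] using h1 p
    · simpa [dDir] using h2 p
  refine ⟨f 0 * planeExp (-c) (-d) 0, fun p => ?_⟩
  rw [is_const_of_fderiv_eq_zero dg h3 0 p, mul_assoc, mul_comm (planeExp (-c) (-d) p),
    planeExp_mul_neg, mul_one]

lemma expEig_zero (l A B : ℂ) (p : ℝ × ℝ) :
    expEig l A B p 0 = A * planeExp (-(Complex.I / (2 * l))) (-(Complex.I * l)) p := by
  simp only [expEig, planeExp, cons_val_zero]
  congr 2; ring

lemma expEig_one (l A B : ℂ) (p : ℝ × ℝ) :
    expEig l A B p 1 = B * planeExp (Complex.I / (2 * l)) (Complex.I * l) p := by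
  change B * Complex.exp _ = B * Complex.exp _
  congr 2; ring

lemma zeroSeed_laxU (l : ℂ) (p : ℝ × ℝ) (w : Fin 2 → ℂ) : (laxU 0 0 1 l p).mulVec w
    = ![-(Complex.I / (2 * l)) * w 0, Complex.I / (2 * l) * w 1] := by
  have h : dFst 0 p = 0 := dFst_const 0 p
  funext s
  fin_cases s <;> simp [laxU, h, mulVec, dotProduct] <;> (left; ring)

lemma zeroSeed_laxV (l : ℂ) (p : ℝ × ℝ) (w : Fin 2 → ℂ) : (laxV 0 0 l p).mulVec w
    = ![-(Complex.I * l) * w 0, Complex.I * l * w 1] := by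
  funext s
  fin_cases s <;> simp [laxV, mulVec, dotProduct]

lemma zeroSeed_isEigenfunction_iff (l : ℂ) (Φ : ℝ × ℝ → Fin 2 → ℂ) :
    IsEigenfunction 0 0 1 l Φ Set.univ ↔ ∃ A B : ℂ, Φ = expEig l A B := by
  constructor
  · intro h
    have hX := fun p => (h.eqn_X p (Set.mem_univ p)).trans (zeroSeed_laxU l p (Φ p))
    have hT := fun p => (h.eqn_T p (Set.mem_univ p)).trans (zeroSeed_laxV l p (Φ p))
    obtain ⟨A, hA⟩ := eq_planeExp (contDiffOn_univ.1 (h.smooth 0))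
      (fun p => congrFun (hX p) 0) (fun p => congrFun (hT p) 0)
    obtain ⟨B, hB⟩ := eq_planeExp (contDiffOn_univ.1 (h.smooth 1))
      (fun p => congrFun (hX p) 1) (fun p => congrFun (hT p) 1)
    refine ⟨A, B, ?_⟩
    funext p s
    fin_cases s
    · exact (hA p).trans (expEig_zero l A B p).symm
    · exact (hB p).trans (expEig_one l A B p).symm
  · rintro ⟨A, B, rfl⟩
    have h0 : (fun p => expEig l A B p 0) = _ := funext (expEig_zero l A B)
    have h1 : (fun p => expEig l A B p 1) = _ := funext (expEig_one l A B)
    refine ⟨fun s => ?_, fun p _ => ?_, fun p _ => ?_⟩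
    · fin_cases s
      · exact h0 ▸ (contDiff_const.mul (contDiff_planeExp _ _)).contDiffOn
      · exact h1 ▸ (contDiff_const.mul (contDiff_planeExp _ _)).contDiffOn
    · rw [zeroSeed_laxU]
      funext s
      fin_cases s
      · change dFst (fun p => expEig l A B p 0) p = _
        rw [h0, dFst_planeExp, ← expEig_zero]; rfl
      · change dFst (fun p => expEig l A B p 1) p = _
        rw [h1, dFst_planeExp, ← expEig_one]; rfl
    · rw [zeroSeed_laxV]
      funext s
      fin_cases s
      · change dSnd (fun p => expEig l A B p 0) p = _
        rw [h0, dSnd_planeExp, ← expEig_zero]; rfl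
      · change dSnd (fun p => expEig l A B p 1) p = _
        rw [h1, dSnd_planeExp, ← expEig_one]; rfl

lemma planeExp_neg (c d : ℂ) (p : ℝ × ℝ) : planeExp c d (-p) = planeExp (-c) (-d) p := by
  simp [planeExp]

lemma hasReduction_expEig {N : ℕ} (lam A B : ℕ → ℂ)
    (h : ∀ k < N, B (2 * k) = A (2 * k) ∧ B (2 * k + 1) = -A (2 * k + 1)) (D : Set (ℝ × ℝ)) :
    HasReduction N (fun j => expEig (lam j) (A j) (B j)) D := fun k hk p _ => by
  simp only [expEig_zero, expEig_one, planeExp_neg, (h k hk).1, (h k hk).2]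
  exact ⟨trivial, by ring⟩

/-! ### Reality for purely imaginary eigenvalues -/

open ComplexConjugate

lemma conj_eq_neg_of_re {l : ℂ} (h : l.re = 0) : conj l = -l := by
  apply Complex.ext <;> simp [h]

/-- For purely imaginary `λ_j` and data proportional to real vectors, complex conjugation of the
linear system shows that the subleading coefficient is purely imaginary. -/
lemma dtCoeff_last_re {N : ℕ} (hN : 1 ≤ N) {lam : ℕ → ℂ} {F : ℕ → Fin 2 → ℂ}
    (hW : (wMat N lam F).det ≠ 0) (hlam : ∀ j < 2 * N, (lam j).re = 0)
    (hF : ∀ j < 2 * N, ∃ (a : ℂ) (g : Fin 2 → ℂ), (∀ s, conj (g s) = g s) ∧ F j = a • g)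
    (r s : Fin 2) : (dtCoeff N lam F (N - 1) r s).re = 0 := by
  have h := eq_dtCoeff hW
    (fun i => of fun r s => (-1 : ℂ) ^ N * (-1) ^ i * conj (dtCoeff N lam F i r s))
    (fun j hj => ?_) (N - 1) (by omega)
  · have h1 := congrFun (congrFun h r) s
    have h2 : (-1 : ℂ) ^ N * (-1) ^ (N - 1) = -1 := by
      rw [← pow_add]; exact Odd.neg_one_pow ⟨N - 1, by omega⟩
    rw [of_apply, h2] at h1
    have h3 := congrArg Complex.re h1
    simp at h3
    linarith
  · obtain ⟨a, g, hg, hFj⟩ := hF j hj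
    funext r
    rcases eq_or_ne a 0 with rfl | ha
    · simp [hFj]
    have h1 := congrFun (dtMat_mulVec_eq_zero hW hj) r
    rw [hFj, mulVec_smul, Pi.smul_apply, dtMat_eq_monicPoly, monicPoly_mulVec_apply] at h1
    have h2 := congrArg conj ((mul_eq_zero.1 h1).resolve_left ha)
    simp only [map_add, map_sum, map_mul, map_pow, map_zero, dotProduct, Fin.sum_univ_two, hg,
      conj_eq_neg_of_re (hlam j hj)] at h2
    rw [hFj, mulVec_smul, Pi.smul_apply, monicPoly_mulVec_apply, Pi.zero_apply, smul_eq_mul]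
    have h3 : lam j ^ N * g r + ∑ i ∈ range N, lam j ^ i *
        ((of fun r s => (-1 : ℂ) ^ N * (-1) ^ i * conj (dtCoeff N lam F i r s)) r ⬝ᵥ g)
        = (-1) ^ N * ((-lam j) ^ N * g r + ∑ i ∈ range N, (-lam j) ^ i *
          (conj (dtCoeff N lam F i r 0) * g 0 + conj (dtCoeff N lam F i r 1) * g 1)) := by
      have hone : (-1 : ℂ) ^ N * (-1) ^ N = 1 := by rw [← mul_pow]; simp
      rw [mul_add, mul_sum]
      congr 1
      · rw [neg_pow (lam j)]
        linear_combination (-(lam j) ^ N * g r) * hone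
      · refine sum_congr rfl fun i _ => ?_
        rw [neg_pow (lam j)]
        simp only [dotProduct, Fin.sum_univ_two, of_apply]
        ring
    rw [h3, h2, mul_zero, mul_zero]

lemma conj_planeExp {c d : ℂ} (hc : conj c = c) (hd : conj d = d) (p : ℝ × ℝ) :
    conj (planeExp c d p) = planeExp c d p := by
  rw [planeExp, ← Complex.exp_conj]
  simp [hc, hd]

/-- For purely imaginary `l` both exponents are real, so the datum is `A` times a real vector. -/
lemma expEig_eq_smul_real {l : ℂ} (hl : l.re = 0) (A : ℂ) {ε : ℂ} (hε : conj ε = ε) (p : ℝ × ℝ) :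
    ∃ (a : ℂ) (g : Fin 2 → ℂ), (∀ s, conj (g s) = g s) ∧ expEig l A (ε * A) p = a • g := by
  have hl' := conj_eq_neg_of_re hl
  have h1 : conj (Complex.I / (2 * l)) = Complex.I / (2 * l) := by
    have h : conj (2 : ℂ) = 2 := map_ofNat _ 2
    simp [hl', neg_div_neg_eq, h]
  have h2 : conj (Complex.I * l) = Complex.I * l := by simp [hl']
  refine ⟨A, ![planeExp (-(Complex.I / (2 * l))) (-(Complex.I * l)) p,
    ε * planeExp (Complex.I / (2 * l)) (Complex.I * l) p], fun s => ?_, ?_⟩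
  · fin_cases s
    · exact conj_planeExp (by rw [map_neg, h1]) (by rw [map_neg, h2]) p
    · change conj (ε * _) = ε * _
      rw [map_mul, hε, conj_planeExp h1 h2]
  · funext s
    fin_cases s
    · exact expEig_zero _ _ _ _
    · refine (expEig_one _ _ _ _).trans ?_
      simp; ring

end ZeroSeed

end ShortPulse

/-! ### The Darboux transformation and the N-soliton solutions -/

theorem mainTheorem1 (N : ℕ) (hN : 1 ≤ N) (lam : ℕ → ℂ) (hlam : ∀ j < 2 * N, lam j ≠ 0) :
    -- algebra of the Darboux matrix, at a point where the eigenvectors have the values `F j`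
    (∀ F : ℕ → Fin 2 → ℂ, (wMat N lam F).det ≠ 0 →
      -- the linear system for the coefficients, and Cramer's rule
      (∀ C : Fin N → Matrix (Fin 2) (Fin 2) ℂ,
        (∀ j < 2 * N, (lam j ^ N • (1 : Matrix (Fin 2) (Fin 2) ℂ)
            + ∑ i : Fin N, lam j ^ (i : ℕ) • C i).mulVec (F j) = 0) ↔
          ∀ i : Fin N, C i = dtCoeff N lam F i) ∧
      (∀ j < 2 * N, (dtMat N lam F (lam j)).mulVec (F j) = 0) ∧
      (∀ r s : Fin 2, dtCoeff N lam F (N - 1) r s = delta N lam F r s / (wMat N lam F).det) ∧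
      -- bordered determinants
      (∀ (z : ℂ) (r s : Fin 2), dtMat N lam F z r s =
        (bordered N lam F (etaRow N s z) (if r = s then z ^ N else 0) r).det
          / (wMat N lam F).det) ∧
      (∀ (z : ℂ) (w : Fin 2 → ℂ) (r : Fin 2), (dtMat N lam F z).mulVec w r =
        (bordered N lam F (xiRow N w z) (z ^ N * w r) r).det / (wMat N lam F).det) ∧
      -- iteration of the one-fold transformation
      ((∀ k, 1 ≤ k → k ≤ N → (wMat k lam F).det ≠ 0) →
        (∀ k < N, oneDet (iterEig lam F k (2 * k)) (iterEig lam F k (2 * k + 1)) ≠ 0) ∧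
        ∀ z : ℂ, iterDT lam F N z = dtMat N lam F z)) ∧
    -- the transformation of an arbitrary seed solution
    (∀ (D : Set (ℝ × ℝ)) (u v ρ : ℝ × ℝ → ℂ) (Φ : ℕ → ℝ × ℝ → Fin 2 → ℂ),
      IsPlaneNonlocalSolution u v ρ D →
      (∀ j < 2 * N, IsEigenfunction u v ρ (lam j) (Φ j) D) →
      -- the iterated potentials
      (∀ p ∈ D, (∀ k, 1 ≤ k → k ≤ N → wDet k lam Φ p ≠ 0) →
        iterU u lam Φ N p = uNew u N lam Φ p ∧
        iterV v lam Φ N p = vNew v N lam Φ p ∧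
        iterRho ρ lam Φ N p = ρNew ρ N lam Φ p) ∧
      -- the Lax pair is transformed into the Lax pair of the new potentials
      (∀ z : ℂ, z ≠ 0 → ∀ p ∈ regSet N lam Φ D,
        Matrix.of (fun r s => dFst (fun y => dtMat N lam (vals Φ y) z r s) p)
            + dtMat N lam (vals Φ p) z * laxU u v ρ z p
          = laxU (uNew u N lam Φ) (vNew v N lam Φ) (ρNew ρ N lam Φ) z p
            * dtMat N lam (vals Φ p) z ∧
        Matrix.of (fun r s => dSnd (fun y => dtMat N lam (vals Φ y) z r s) p)
            + dtMat N lam (vals Φ p) z * laxV u v z p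
          = laxV (uNew u N lam Φ) (vNew v N lam Φ) z p * dtMat N lam (vals Φ p) z) ∧
      (∀ z : ℂ, z ≠ 0 → ∀ Ψ : ℝ × ℝ → Fin 2 → ℂ, IsEigenfunction u v ρ z Ψ D →
        IsEigenfunction (uNew u N lam Φ) (vNew v N lam Φ) (ρNew ρ N lam Φ) z
          (fun p => (dtMat N lam (vals Φ p) z).mulVec (Ψ p)) (regSet N lam Φ D)) ∧
      -- the new potentials are solutions in the `(X,T)`-plane
      IsPlaneSystemSolution (uNew u N lam Φ) (vNew v N lam Φ) (ρNew ρ N lam Φ)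
        (regSet N lam Φ D) ∧
      (HasReduction N Φ D →
        IsPlaneNonlocalSolution (uNew u N lam Φ) (vNew v N lam Φ) (ρNew ρ N lam Φ)
          (regSet N lam Φ D)) ∧
      -- the hodograph transformation, for any choice of the integration constant
      (∀ x₀ : ℝ × ℝ → ℂ, IsHodograph u v ρ x₀ D →
        IsHodograph (uNew u N lam Φ) (vNew v N lam Φ) (ρNew ρ N lam Φ) (xNew x₀ N lam Φ)
          (regSet N lam Φ D) ∧
        (∀ O : Set (ℝ × ℝ), IsRegion (xNew x₀ N lam Φ) (regSet N lam Φ D) O →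
          (∀ q r : ℝ × ℝ → ℂ,
            (∀ p ∈ O, q (hodMap (xNew x₀ N lam Φ) p) = uNew u N lam Φ p) →
            (∀ p ∈ O, r (hodMap (xNew x₀ N lam Φ) p) = vNew v N lam Φ p) →
            IsSPSystemSolution q r (hodMap (xNew x₀ N lam Φ) '' O)) ∧
          (∀ p₀ ∈ O, ∃ O' ⊆ O, p₀ ∈ O' ∧ IsOpen O' ∧
            Set.InjOn (hodMap (xNew x₀ N lam Φ)) O')) ∧
        -- the nonlocal equation, for the symmetric choice of the integration constant
        (HasReduction N Φ D →
          (∀ p ∈ D, x₀ p + x₀ (-p) = 2 * Complex.I * (∑ j ∈ Finset.range (2 * N), lam j)) →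
          IsParametricSolution (uNew u N lam Φ) (xNew x₀ N lam Φ) (regSet N lam Φ D) ∧
          (∀ O : Set (ℝ × ℝ), IsRegion (xNew x₀ N lam Φ) (regSet N lam Φ D) O →
            IsReflSymm O →
            (∀ q : ℝ × ℝ → ℂ,
              (∀ p ∈ O, q (hodMap (xNew x₀ N lam Φ) p) = uNew u N lam Φ p) →
              IsNonlocalSPSolution q (hodMap (xNew x₀ N lam Φ) '' O)) ∧
            (∀ p₀ ∈ O, (p₀ = 0 ∨ hodMap (xNew x₀ N lam Φ) p₀ ≠ 0) →
              ∃ O' ⊆ O, p₀ ∈ O' ∧ IsOpen O' ∧ IsReflSymm O' ∧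
                Set.InjOn (hodMap (xNew x₀ N lam Φ)) O'))))) ∧
    -- zero seed
    (IsPlaneNonlocalSolution 0 0 1 Set.univ ∧
      (∀ C : ℂ, IsHodograph 0 0 1 (fun p => (p.1 : ℂ) + C) Set.univ) ∧
      (∀ l : ℂ, l ≠ 0 → ∀ Φ : ℝ × ℝ → Fin 2 → ℂ,
        IsEigenfunction 0 0 1 l Φ Set.univ ↔ ∃ A B : ℂ, Φ = expEig l A B) ∧
      ∀ A B : ℕ → ℂ, (∀ k < N, B (2 * k) = A (2 * k) ∧ B (2 * k + 1) = -A (2 * k + 1)) →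
        ∀ (Φ : ℕ → ℝ × ℝ → Fin 2 → ℂ) (Ω : Set (ℝ × ℝ)) (q x : ℝ × ℝ → ℂ),
          Φ = (fun j => expEig (lam j) (A j) (B j)) →
          Ω = {p | wDet N lam Φ p ≠ 0} →
          q = (fun p => 2 * Complex.I * (delta N lam (vals Φ p) 0 1 / wDet N lam Φ p)) →
          x = (fun p => (p.1 : ℂ) + Complex.I * (∑ j ∈ Finset.range (2 * N), lam j)
            + 2 * Complex.I * (delta N lam (vals Φ p) 0 0 / wDet N lam Φ p)) →
          HasReduction N Φ Set.univ ∧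
          IsParametricSolution q x Ω ∧
          (∀ O : Set (ℝ × ℝ), IsRegion x Ω O → IsReflSymm O →
            ∀ Q : ℝ × ℝ → ℂ, (∀ p ∈ O, Q (hodMap x p) = q p) →
              IsNonlocalSPSolution Q (hodMap x '' O)) ∧
          ((∀ j < 2 * N, (lam j).re = 0) → ∀ p ∈ Ω, (x p).im = 0 ∧ (q p).im = 0)) := by
  refine ⟨fun F hW => ⟨linear_system_iff hW, fun j hj => dtMat_mulVec_eq_zero hW hj,
    dtCoeff_last N lam F, dtMat_apply_eq_bordered hW, dtMat_mulVec_eq_bordered hW,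
    fun hWk => ⟨fun k hk => iterEig_oneDet_ne_zero hWk hk, iterDT_eq_dtMat N hWk⟩⟩, ?_,
    zeroSeed_isSolution, zeroSeed_isHodograph, fun l _ => zeroSeed_isEigenfunction_iff l, ?_⟩
  · intro D u v ρ Φ hs hΦ
    have hΦs : ∀ j < 2 * N, ∀ s, ContDiffOn ℝ ∞ (fun p => Φ j p s) D :=
      fun j hj => (hΦ j hj).smooth
    have hnew := isPlaneSystemSolution_new hN hlam hs hΦ
    refine ⟨fun p hp hW => ?_, fun z hz p hp => ⟨?_, ?_⟩,
      fun z hz Ψ hΨ => isEigenfunction_new hN hlam hs hΦ hz hΨ, hnew,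
      fun hR => hnew.toNonlocal (isReflSymm_regSet hs.symm hR)
        fun p hp => vNew_eq_neg hN hs hR hp, fun x₀ hx₀ => ?_⟩
    · have h := iterated_potentials (u := u) (v := v) (ρ := ρ) hs.isOpen hΦs le_rfl p hp hW
      simpa only [show N ≠ 0 by omega, if_false] using h
    · rw [dFst_dtMat hs.isOpen hΦs hp]
      exact darboux_X hN hlam hs hΦ hz hp
    · rw [dSnd_dtMat hs.isOpen hΦs hp]
      exact darboux_T hN hs hΦ z hp
    · have hx := isHodograph_new hN hs hΦ hx₀
      refine ⟨hx, fun O hO => ⟨fun q r hq hr => hO.isSPSystemSolution hnew hx hq hr,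
        fun p hp => hO.exists_injOn (hx.smooth.mono hO.subset) hp⟩, fun hR hsum => ?_⟩
      have hodd : ∀ p ∈ regSet N lam Φ D, xNew x₀ N lam Φ (-p) = -xNew x₀ N lam Φ p :=
        fun p hp => xNew_odd hN hs.symm hR hsum hp
      have hv : ∀ p ∈ regSet N lam Φ D, vNew v N lam Φ p = -uNew u N lam Φ (-p) :=
        fun p hp => vNew_eq_neg hN hs hR hp
      exact ⟨isParametricSolution_of_odd hnew (isReflSymm_regSet hs.symm hR) hx hodd hv,
        fun O hO hOs => ⟨fun q hq => hO.isNonlocalSPSolution hnew hx hodd hv hOs hq,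
          fun p hp h0 => hO.exists_injOn_symm (hx.smooth.mono hO.subset) hodd hOs hp h0⟩⟩
  · rintro A B hAB Φ Ω q x rfl hΩ hq hx
    set Φ : ℕ → ℝ × ℝ → Fin 2 → ℂ := fun j => expEig (lam j) (A j) (B j) with hΦdef
    have hR : HasReduction N Φ Set.univ := hasReduction_expEig lam A B hAB Set.univ
    have hΦ : ∀ j < 2 * N, IsEigenfunction 0 0 1 (lam j) (Φ j) Set.univ := fun j _ =>
      (zeroSeed_isEigenfunction_iff (lam j) (Φ j)).2 ⟨A j, B j, rfl⟩
    have hs := zeroSeed_isSolution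
    have hΩ' : Ω = regSet N lam Φ Set.univ := by rw [hΩ]; ext p; simp [regSet]
    have hq' : q = uNew 0 N lam Φ := by rw [hq]; funext p; simp [uNew]
    have hx' : x = xNew (fun p => (p.1 : ℂ) + Complex.I * (∑ j ∈ Finset.range (2 * N), lam j))
        N lam Φ := hx
    have hnew := isPlaneSystemSolution_new hN hlam hs hΦ
    have hhod := isHodograph_new hN hs hΦ
      (zeroSeed_isHodograph (Complex.I * ∑ j ∈ Finset.range (2 * N), lam j))
    have hodd : ∀ p ∈ regSet N lam Φ Set.univ, x (-p) = -x p := fun p hp => by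
      rw [hx']
      refine xNew_odd hN hs.symm hR (fun p _ => ?_) hp
      simp only [Prod.fst_neg, Complex.ofReal_neg]
      ring
    have hv : ∀ p ∈ regSet N lam Φ Set.univ, vNew 0 N lam Φ p = -uNew 0 N lam Φ (-p) :=
      fun p hp => vNew_eq_neg hN hs hR hp
    rw [← hx'] at hhod
    refine ⟨hR, ?_, fun O hO hOs Q hQ => ?_, fun hre p hp => ?_⟩
    · rw [hΩ', hq']
      exact isParametricSolution_of_odd hnew (isReflSymm_regSet hs.symm hR) hhod hodd hv
    · rw [hΩ'] at hO
      rw [hq'] at hQ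
      exact hO.isNonlocalSPSolution hnew hhod hodd hv hOs hQ
    · rw [hΩ] at hp
      have hC := dtCoeff_last_re hN (F := vals Φ p) hp hre fun j hj => by
        obtain ⟨ε, hε, hB⟩ : ∃ ε : ℂ, (starRingEnd ℂ) ε = ε ∧ B j = ε * A j := by
          rcases Nat.even_or_odd' j with ⟨k, rfl | rfl⟩
          · exact ⟨1, map_one _, by rw [(hAB k (by omega)).1, one_mul]⟩
          · exact ⟨-1, by simp, by rw [(hAB k (by omega)).2, neg_one_mul]⟩
        simp only [vals, hΦdef, hB]
        exact expEig_eq_smul_real (hre j hj) (A j) hε p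
      have hsum : (∑ j ∈ Finset.range (2 * N), lam j).re = 0 := by
        rw [Complex.re_sum]
        exact Finset.sum_eq_zero fun j hj => hre j (Finset.mem_range.1 hj)
      have him : ∀ r s, (2 * Complex.I * (delta N lam (vals Φ p) r s / wDet N lam Φ p)).im = 0 :=
        fun r s => by
          have h := hC r s
          rw [dtCoeff_last] at h
          rw [mul_assoc, Complex.mul_im, Complex.I_mul_im]
          simp [wDet, h]
      rw [hq, hx]
      refine ⟨?_, him 0 1⟩
      simp only [Complex.add_im, him 0 0, Complex.I_mul_im, hsum, Complex.ofReal_im, add_zero]
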